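/- Throughout, systems are finite-dimensional with fixed bases, $A\leqslant B$ means that $B-A$ is positive semidefinite, and $\ln$ and inverses of positive semidefinite operators are taken on the support (and are zero on the kernel). For a state $\rho$ and $\tau\geqslant 0$ with $\operatorname{supp}\rho\subseteq\operatorname{supp}\tau$ put $$D(\rho\Vert\tau)=\operatorname{tr}[\rho(\ln\rho-\ln\tau)],\qquad D_M(\rho\Vert\tau)=-\operatorname{tr}[\rho\ln\tau].$$ For sub-normalized states let $P(\rho,\tau)=\sqrt{1-\bar F(\rho,\tau)^2}$ be the purified distance, where $\bar F(\rho,\tau)=\Vert\sqrt\rho\sqrt\tau\Vert_1+\sqrt{(1-\operatorname{tr}\rho)(1-\operatorname{tr}\tau)}$. Given $\delta>0$, a family of orthogonal projectors $(\Pi^{n})_{n\in\mathbb N}$ on the $n$-fold tensor power of the Hilbert space is called a *relative typical projector* $\Pi^{n,\delta}_{\rho|\tau}$ if for all $n$ $$[\Pi^{n},\tau^{\otimes n}]=0,\qquad e^{-n(D_M(\rho\Vert\tau)+\delta)}\,\Pi^{n}\leqslant\Pi^{n}\tau^{\otimes n}\Pi^{n}\leqslant e^{-n(D_M(\rho\Vert\tau)-\delta)}\,\Pi^{n},$$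 and there is $\eta>0$, independent of $n$, with $\operatorname{tr}(\Pi^{n}\rho^{\otimes n})\geqslant 1-2e^{-n\eta}$ for all $n$. The standard choice is the spectral projector of $\tau^{\otimes n}$ for its eigenvalues in the interval $[e^{-n(D_M(\rho\Vert\tau)+\delta)},e^{-n(D_M(\rho\Vert\tau)-\delta)}]$. For $\epsilon>0$, a process matrix $\rho_{X'R}$ obtained from a purified input state $\sigma_{XR}$, and $\Gamma_X,\Gamma_{X'}\geqslant0$, the $\epsilon$-smooth coherent relative entropy is $$\hat D^{\epsilon}_{X\to X'}(\rho_{X'R}\Vert\Gamma_X,\Gamma_{X'})=-\ln\,\inf\{\alpha\geqslant 0:\ \mathcal T(\Gamma_X)\leqslant\alpha\Gamma_{X'},\ P(\mathcal T(\sigma_{XR}),\rho_{X'R})\leqslant\epsilon\}\in[-\infty,\infty],$$ where $\mathcal T_{X\to X'}$ ranges over the completely positive, trace non-increasing maps (acting as the identity on $R$), with $\inf\emptyset=+\infty$. **Proposition.** Let $\Gamma_X,\Gamma_{X'}\geqslant0$, let $\mathcal E_{X\to X'}$ be a completely positive, trace-preserving map, let $R_X\simeq X$, and let $|\sigma\rangle_{XR_X}$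 be any pure state, with $\sigma_{XR_X}=|\sigma\rangle\langle\sigma|$ and reduced state $\sigma_X$. Let $\rho_{X'R_X}=(\mathcal E\otimes\mathrm{id}_{R_X})(\sigma_{XR_X})$, so that $\rho_{X'}=\mathcal E(\sigma_X)$. Assume $\operatorname{supp}\sigma_X\subseteq\operatorname{supp}\Gamma_X$ and $\operatorname{supp}\rho_{X'}\subseteq\operatorname{supp}\Gamma_{X'}$. 1. For every $\delta>0$ the standard choices of the projectors $$S_{X'^n}=\Pi^{n,\delta}_{\rho_{X'}|\Gamma_{X'}^{-1}},\quad Q_{X'^n}=\Pi^{n,\delta}_{\rho_{X'}|\rho_{X'}},\quad P_{X^n}=\Pi^{n,\delta}_{\sigma_X|\Gamma_X},\quad R_{X^n}=\Pi^{n,\delta}_{\sigma_X|\sigma_X}$$ are relative typical projectors in the above sense. 2. For every $\delta>0$ and all (standard or other) relative typical projectors $S,Q,P,R$ as in 1., the map $$\mathcal T_{X^n\to X'^n}(\cdot)=S_{X'^n}Q_{X'^n}\,\mathcal E^{\otimes n}\big(R_{X^n}P_{X^n}\,(\cdot)\,P_{X^n}R_{X^n}\big)\,Q_{X'^n}S_{X'^n}$$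 is, for every $n$, completely positive and trace non-increasing, and satisfies $$\mathcal T_{X^n\to X'^n}(\Gamma_X^{\otimes n})\leqslant e^{-n[D(\sigma_X\Vert\Gamma_X)-D(\rho_{X'}\Vert\Gamma_{X'})-4\delta]}\;\Gamma_{X'}^{\otimes n};$$ moreover there is $\eta'>0$, independent of $n$, such that for all $n$ $$P\big(\mathcal T_{X^n\to X'^n}(\sigma_{XR_X}^{\otimes n}),\rho_{X'R_X}^{\otimes n}\big)\leqslant 4e^{-n\eta'}.$$ 3. For every $\epsilon>0$ the following limit exists in $[-\infty,\infty]$ and satisfies $$\lim_{n\to\infty}\frac1n\,\hat D^{\epsilon}_{X^n\to X'^n}\big(\rho_{X'R_X}^{\otimes n}\,\Vert\,\Gamma_X^{\otimes n},\Gamma_{X'}^{\otimes n}\big)\ \geqslant\ D(\sigma_X\Vert\Gamma_X)-D(\rho_{X'}\Vert\Gamma_{X'}).$$ -/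

import Mathlib

open scoped MatrixOrder ComplexOrder NNReal ENNReal Topology Kronecker
open Filter

namespace QInfo

noncomputable section

/-! Finite-dimensional quantum systems with a distinguished basis indexed by a finite type;
operators are complex matrices in that basis, `A ≤ B` is the positive semidefinite order. -/

section Basic

variable {ι κ r : Type*} [Fintype ι] [DecidableEq ι] [Fintype κ] [DecidableEq κ]
  [Fintype r] [DecidableEq r]

/-- The rank-one operator `|ψ⟩⟨ψ|`. -/
def ketBra (ψ : ι → ℂ) : Matrix ι ι ℂ := Matrix.vecMulVec ψ (star ψ)

/-- `ψ` is a normalized ket, i.e. a pure state. -/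
def IsUnitKet (ψ : ι → ℂ) : Prop := ∑ i, ‖ψ i‖ ^ 2 = 1

/-- The reduced operator on the first factor: `tr_R M`. -/
def ptraceRight (M : Matrix (ι × r) (ι × r) ℂ) : Matrix ι ι ℂ :=
  Matrix.of fun i j => ∑ k, M (i, k) (j, k)

/-- `(E ⊗ id_R)(M)`: the map `E` acts on the first factor. -/
def applyLeft (E : Matrix ι ι ℂ →ₗ[ℂ] Matrix κ κ ℂ) (M : Matrix (ι × r) (ι × r) ℂ) :
    Matrix (κ × r) (κ × r) ℂ :=
  Matrix.of fun p q => E (Matrix.of fun i j => M (i, p.2) (j, q.2)) p.1 q.1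

/-- The unnormalized maximally entangled reference ket `∑ₖ |k⟩ ⊗ |k⟩`. -/
def maxEntKet (ι : Type*) [DecidableEq ι] : ι × ι → ℂ := fun p => if p.1 = p.2 then 1 else 0

/-- Complete positivity: `(E ⊗ id_R)(|Φ⟩⟨Φ|) ≥ 0`, with `R` a copy of the input system. -/
def IsCompletelyPositive (E : Matrix ι ι ℂ →ₗ[ℂ] Matrix κ κ ℂ) : Prop :=
  (applyLeft E (ketBra (maxEntKet ι))).PosSemidef

def IsTracePreserving (E : Matrix ι ι ℂ →ₗ[ℂ] Matrix κ κ ℂ) : Prop :=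
  ∀ A, (E A).trace = A.trace

def IsTraceNonincreasing (E : Matrix ι ι ℂ →ₗ[ℂ] Matrix κ κ ℂ) : Prop :=
  ∀ A : Matrix ι ι ℂ, A.PosSemidef → (E A).trace.re ≤ A.trace.re

/-- The support of `ρ` is contained in the support of `τ` (for Hermitian `ρ`, `τ`, whose
supports are the orthogonal complements of their kernels). -/
def SuppLE (ρ τ : Matrix ι ι ℂ) : Prop := ∀ v : ι → ℂ, τ.mulVec v = 0 → ρ.mulVec v = 0

/-- The logarithm of a positive semidefinite operator, taken on its support
(`Real.log 0 = 0`, so the kernel is sent to zero). -/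
def opLog (A : Matrix ι ι ℂ) : Matrix ι ι ℂ := cfc Real.log A

/-- The inverse of a positive semidefinite operator on its support
(zero on the kernel); the ordinary inverse if the operator is positive definite. -/
def opInv (A : Matrix ι ι ℂ) : Matrix ι ι ℂ := cfc (fun x : ℝ => x⁻¹) A

/-- The square root of a positive semidefinite operator. -/
def opSqrt (A : Matrix ι ι ℂ) : Matrix ι ι ℂ := cfc Real.sqrt A

/-- `D(ρ‖τ) = tr[ρ (ln ρ - ln τ)]`, for `supp ρ ⊆ supp τ`. -/
def relEntropy (ρ τ : Matrix ι ι ℂ) : ℝ := (ρ * (opLog ρ - opLog τ)).trace.re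

/-- `D_M(ρ‖τ) = -tr[ρ ln τ]`, for `supp ρ ⊆ supp τ`. -/
def crossEntropy (ρ τ : Matrix ι ι ℂ) : ℝ := -(ρ * opLog τ).trace.re

/-- The one-norm `‖A‖₁ = tr √(A† A)`. -/
def traceNorm (A : Matrix ι ι ℂ) : ℝ := (opSqrt (A.conjTranspose * A)).trace.re

/-- The generalized fidelity of two sub-normalized states. -/
def genFidelity (ρ τ : Matrix ι ι ℂ) : ℝ :=
  traceNorm (opSqrt ρ * opSqrt τ) + Real.sqrt ((1 - ρ.trace.re) * (1 - τ.trace.re))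

/-- The purified distance of two sub-normalized states. -/
def purifiedDist (ρ τ : Matrix ι ι ℂ) : ℝ := Real.sqrt (1 - genFidelity ρ τ ^ 2)

/-- The `ε`-smooth coherent relative entropy
`-ln min {α : T(Γ) ≤ α Γ', P(T(σ_{XR}), ρ_{X'R}) ≤ ε}`, with `T` ranging over the completely
positive, trace non-increasing maps, for the process matrix `ρ_{X'R}` obtained from the
purified input state `σ_{XR}`. It is `⊤` if the minimum is `0`, and `⊥` if no `α` is feasible. -/
def cohRelEntropy (ε : ℝ) (σXR : Matrix (ι × r) (ι × r) ℂ) (ρXR : Matrix (κ × r) (κ × r) ℂ)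
    (Γ : Matrix ι ι ℂ) (Γ' : Matrix κ κ ℂ) : EReal :=
  -ENNReal.log (⨅ α ∈ {α : ℝ≥0 | ∃ T : Matrix ι ι ℂ →ₗ[ℂ] Matrix κ κ ℂ,
    IsCompletelyPositive T ∧ IsTraceNonincreasing T ∧ T Γ ≤ (α : ℝ) • Γ' ∧
      purifiedDist (applyLeft T σXR) ρXR ≤ ε}, (α : ℝ≥0∞))

end Basic

section IID

variable {ι κ r : Type*} [Fintype ι] [DecidableEq ι] [Fintype κ] [DecidableEq κ]
  [Fintype r] [DecidableEq r]

/-- `A^{⊗n}`, on the `n`-copy system with basis indexed by `Fin n → ι`. -/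
def tensorPow (A : Matrix ι ι ℂ) (n : ℕ) : Matrix (Fin n → ι) (Fin n → ι) ℂ :=
  Matrix.of fun f g => ∏ k, A (f k) (g k)

/-- `M_{XR}^{⊗n}`, regarded as an operator on `X^n ⊗ R^n`. -/
def tensorPow₂ (M : Matrix (ι × r) (ι × r) ℂ) (n : ℕ) :
    Matrix ((Fin n → ι) × (Fin n → r)) ((Fin n → ι) × (Fin n → r)) ℂ :=
  Matrix.of fun p q => ∏ k, M (p.1 k, p.2 k) (q.1 k, q.2 k)

/-- `E^{⊗n}`: the linear map with `|a⟩⟨b| ↦ ⨂ₖ E(|aₖ⟩⟨bₖ|)` on matrix units. -/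
def tensorPowMap (E : Matrix ι ι ℂ →ₗ[ℂ] Matrix κ κ ℂ) (n : ℕ) :
    Matrix (Fin n → ι) (Fin n → ι) ℂ →ₗ[ℂ] Matrix (Fin n → κ) (Fin n → κ) ℂ where
  toFun A := Matrix.of fun f g =>
    ∑ a, ∑ b, A a b * ∏ k, E (Matrix.single (a k) (b k) 1) (f k) (g k)
  map_add' A B := by
    ext f g
    simp [add_mul, Finset.sum_add_distrib]
  map_smul' c A := by
    ext f g
    simp [Finset.mul_sum, mul_assoc]

/-- The family `Pr n` consists of relative typical projectors `Π^{n,δ}_{ρ|τ}`: they commute with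
`τ^{⊗n}`, the eigenvalues of `τ^{⊗n}` on them are `e^{-n(D_M(ρ‖τ) ± δ)}`, and they have
exponentially good weight on `ρ^{⊗n}`. -/
def IsRelTypical (ρ τ : Matrix ι ι ℂ) (δ : ℝ)
    (Pr : ∀ n : ℕ, Matrix (Fin n → ι) (Fin n → ι) ℂ) : Prop :=
  (∀ n, IsStarProjection (Pr n) ∧ Commute (Pr n) (tensorPow τ n) ∧
    Real.exp (-(n * (crossEntropy ρ τ + δ))) • Pr n ≤ Pr n * tensorPow τ n * Pr n ∧
    Pr n * tensorPow τ n * Pr n ≤ Real.exp (-(n * (crossEntropy ρ τ - δ))) • Pr n) ∧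
  ∃ η : ℝ, 0 < η ∧ ∀ n : ℕ,
    1 - 2 * Real.exp (-(n * η)) ≤ (Pr n * tensorPow ρ n).trace.re

/-- The standard relative typical projector: the spectral projector of `τ^{⊗n}` for the
eigenvalues `t > 0` with `|-(1/n) ln t - D_M(ρ‖τ)| ≤ δ`. -/
def relTypProj (ρ τ : Matrix ι ι ℂ) (δ : ℝ) (n : ℕ) : Matrix (Fin n → ι) (Fin n → ι) ℂ :=
  cfc (Set.indicator (Set.Icc (Real.exp (-(n * (crossEntropy ρ τ + δ))))
    (Real.exp (-(n * (crossEntropy ρ τ - δ))))) (fun _ => (1 : ℝ))) (tensorPow τ n)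

end IID

/-- The map `A ↦ S Q F(R P A P R) Q S`. -/
def sandwich {a b : Type*} [Fintype a] [Fintype b]
    (F : Matrix a a ℂ →ₗ[ℂ] Matrix b b ℂ) (S Q : Matrix b b ℂ) (P R : Matrix a a ℂ) :
    Matrix a a ℂ →ₗ[ℂ] Matrix b b ℂ where
  toFun A := S * Q * F (R * P * A * P * R) * Q * S
  map_add' A B := by simp [mul_add, add_mul]
  map_smul' c A := by simp

end

end QInfo

/-! The Γ-bound is a chain of four operator inequalities. Write `D_M` for `crossEntropy`, and `H(σ)
= D_M(σ‖σ)`. On typical subspaces every operator involved is flat up to `e^{±nδ}`: `P Γ^{⊗n} P` is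
at most `e^{-n D_M(σ‖Γ)} P`, `R` is at most `e^{n H(σ)} σ^{⊗n}`, the channel sends `σ^{⊗n}` to
`ρ^{⊗n}`, `Q ρ^{⊗n} Q` is at most `e^{-n H(ρ)} Q`, and `S` is at most `e^{n D_M(ρ‖Γ')} Γ'^{⊗n}`.
Since `D = D_M - H`, the product is the claimed factor, each link costing one `δ` (`sandwich_le`,
`sandwich_tensorPow`).

Typicality of the spectral projectors is classical: the diagonal of `ρ` in an eigenbasis of `τ` is a
probability distribution, and the weight is the probability that an empirical mean of `-ln t` is
`δ`-close to `D_M(ρ‖τ)`. A Chernoff bound gives the rate (`exists_large_deviation`).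

For the distance, bipartite kets are treated as matrices and channels as Stinespring operators
acting from the left. Projections of nearly full weight move such a matrix little in Hilbert–Schmidt
norm (`hsNorm_sub_mul_mul_le`), and the overlap of purifications bounds the fidelity from below
(`re_trace_le_traceNorm_sqrt_mul_sqrt`).

Existence of the limit needs a converse. If `ε < 1` and `T` is feasible with factor `α`, the output
has fidelity at least `√(1 - ε²)` with a state that nearly passes the test `S Q`, where `S` is now
typical for `Γ'` itself. The same flatness estimates bound the passing probability by about `α
e^{n(D(σ‖Γ) - D(ρ‖Γ') + 4δ)}`, so `α` cannot be smaller than the claimed rate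
(`sqrt_le_of_purifiedDist_le`). Hence the limit equals the right-hand side for `ε < 1`. For `ε ≥ 1`
the zero map is feasible and the limit is `⊤`. -/

namespace QInfo

noncomputable section

open Matrix

set_option linter.unusedSectionVars false

/-! ### Hilbert–Schmidt norm and contractions. -/

section HilbertSchmidt

variable {m n k l : Type*} [Fintype m] [Fintype n] [Fintype k] [Fintype l]

/-- A matrix as a vector of the Hilbert–Schmidt space. -/
def hsVec (A : Matrix m n ℂ) : EuclideanSpace ℂ (m × n) := WithLp.toLp 2 fun p => A p.1 p.2

/-- The Hilbert–Schmidt norm. -/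
def hsNorm (A : Matrix m n ℂ) : ℝ := ‖hsVec A‖

lemma inner_hsVec (A B : Matrix m n ℂ) : inner ℂ (hsVec A) (hsVec B) = (Aᴴ * B).trace := by
  simp only [hsVec, PiLp.inner_apply, Matrix.trace, Matrix.diag, Matrix.mul_apply,
    Matrix.conjTranspose_apply, Fintype.sum_prod_type]
  rw [Finset.sum_comm]
  simp [mul_comm]

lemma hsNorm_nonneg (A : Matrix m n ℂ) : 0 ≤ hsNorm A := norm_nonneg _

lemma hsNorm_sq (A : Matrix m n ℂ) : hsNorm A ^ 2 = (Aᴴ * A).trace.re := by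
  rw [← inner_hsVec, hsNorm, ← inner_self_eq_norm_sq (𝕜 := ℂ)]; rfl

lemma hsNorm_sq' (A : Matrix m n ℂ) : hsNorm A ^ 2 = (A * Aᴴ).trace.re := by
  rw [hsNorm_sq, Matrix.trace_mul_comm]

lemma hsNorm_conjTranspose (A : Matrix m n ℂ) : hsNorm Aᴴ = hsNorm A := by
  rw [← sq_eq_sq₀ (hsNorm_nonneg _) (hsNorm_nonneg _), hsNorm_sq, hsNorm_sq',
    Matrix.conjTranspose_conjTranspose]

lemma hsNorm_add_le (A B : Matrix m n ℂ) : hsNorm (A + B) ≤ hsNorm A + hsNorm B :=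
  norm_add_le (hsVec A) (hsVec B)

lemma re_trace_conjTranspose_mul_le (A B : Matrix m n ℂ) :
    (Aᴴ * B).trace.re ≤ hsNorm A * hsNorm B := by
  rw [← inner_hsVec]
  exact (Complex.re_le_norm _).trans (norm_inner_le_norm _ _)

lemma trace_re_mono {A B : Matrix m m ℂ} (h : A ≤ B) : A.trace.re ≤ B.trace.re := by
  have := (Complex.le_def.1 (Matrix.PosSemidef.trace_nonneg (Matrix.le_iff.1 h))).1
  simpa [Matrix.trace_sub] using this

lemma conj_mono {A B : Matrix m m ℂ} (h : A ≤ B) (C : Matrix n m ℂ) :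
    C * A * Cᴴ ≤ C * B * Cᴴ := by
  rw [Matrix.le_iff] at *
  have := h.mul_mul_conjTranspose_same C
  rwa [Matrix.mul_sub, Matrix.sub_mul] at this

lemma conj_mono' {A B : Matrix m m ℂ} (h : A ≤ B) (C : Matrix m n ℂ) :
    Cᴴ * A * C ≤ Cᴴ * B * C := by
  simpa using conj_mono h Cᴴ

variable [DecidableEq n] [DecidableEq k]

/-- `A` is a contraction. -/
def IsContr (A : Matrix m n ℂ) : Prop := Aᴴ * A ≤ 1

lemma IsContr.mul {A : Matrix m n ℂ} {B : Matrix n k ℂ} (hA : IsContr A) (hB : IsContr B) :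
    IsContr (A * B) := by
  have h := conj_mono' hA B
  rw [IsContr] at *
  rw [Matrix.conjTranspose_mul, Matrix.mul_assoc, ← Matrix.mul_assoc Aᴴ, ← Matrix.mul_assoc]
  exact h.trans (by simpa using hB)

lemma IsContr.hsNorm_mul_le {A : Matrix m n ℂ} (hA : IsContr A) (B : Matrix n l ℂ) :
    hsNorm (A * B) ≤ hsNorm B := by
  refine le_of_sq_le_sq ?_ (hsNorm_nonneg _)
  rw [hsNorm_sq, hsNorm_sq]
  refine trace_re_mono ?_
  have h := conj_mono' hA B
  rw [Matrix.conjTranspose_mul, Matrix.mul_assoc, ← Matrix.mul_assoc Aᴴ, ← Matrix.mul_assoc]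
  simpa using h

lemma isContr_of_isStarProjection [DecidableEq m] {P : Matrix m m ℂ}
    (hP : IsStarProjection P) : IsContr P := by
  rw [IsContr, ← Matrix.star_eq_conjTranspose, hP.isSelfAdjoint.star_eq, hP.isIdempotentElem.eq]
  exact hP.le_one

lemma isContr_of_conjTranspose_mul_self_idem {A : Matrix m n ℂ}
    (h : Aᴴ * A * (Aᴴ * A) = Aᴴ * A) : IsContr A := by
  have : IsStarProjection (Aᴴ * A) := ⟨h, by simp [IsSelfAdjoint, Matrix.star_eq_conjTranspose]⟩
  exact this.le_one

end HilbertSchmidt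

/-! ### Polar decomposition, trace norm and gentle measurement. -/

section FunctionalCalculus

variable {m n : Type*} [Fintype m] [Fintype n] [DecidableEq m]

lemma cfc_matrix_mul (A : Matrix m m ℂ) (f g : ℝ → ℝ) :
    cfc f A * cfc g A = cfc (fun x => f x * g x) A :=
  (cfc_mul f g A (Matrix.finite_real_spectrum.continuousOn f)
    (Matrix.finite_real_spectrum.continuousOn g)).symm

lemma cfc_matrix_id {A : Matrix m m ℂ} (hA : A.IsHermitian) : cfc (fun x : ℝ => x) A = A :=
  cfc_id' ℝ A hA.isSelfAdjoint

lemma cfc_matrix_congr {A : Matrix m m ℂ} (hA : A.PosSemidef) {f g : ℝ → ℝ}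
    (h : ∀ x, 0 ≤ x → f x = g x) : cfc f A = cfc g A :=
  cfc_congr fun _ hx => h _ (spectrum_nonneg_of_nonneg (Matrix.nonneg_iff_posSemidef.2 hA) hx)

lemma cfc_matrix_isHermitian (A : Matrix m m ℂ) (f : ℝ → ℝ) : (cfc f A)ᴴ = cfc f A :=
  (cfc_predicate f A : IsSelfAdjoint _).star_eq

lemma cfc_matrix_posSemidef {A : Matrix m m ℂ} (hA : A.PosSemidef) {f : ℝ → ℝ}
    (h : ∀ x, 0 ≤ x → 0 ≤ f x) : (cfc f A).PosSemidef :=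
  Matrix.nonneg_iff_posSemidef.1 <| cfc_nonneg fun x hx =>
    h x (spectrum_nonneg_of_nonneg (Matrix.nonneg_iff_posSemidef.2 hA) hx)

lemma opSqrt_mul_self {A : Matrix m m ℂ} (hA : A.PosSemidef) : opSqrt A * opSqrt A = A := by
  rw [opSqrt, cfc_matrix_mul]
  conv_rhs => rw [← cfc_matrix_id hA.1]
  exact cfc_matrix_congr hA fun x hx => Real.mul_self_sqrt hx

lemma opSqrt_isHermitian (A : Matrix m m ℂ) : (opSqrt A)ᴴ = opSqrt A := cfc_matrix_isHermitian _ _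

/-- Polar decomposition. -/
lemma exists_polar [DecidableEq n] (W : Matrix m n ℂ) :
    ∃ U : Matrix m n ℂ, W = opSqrt (W * Wᴴ) * U ∧ U * Wᴴ = opSqrt (W * Wᴴ) ∧
      IsContr U ∧ IsContr Uᴴ := by
  set ω := W * Wᴴ with hω
  have hp : ω.PosSemidef := Matrix.posSemidef_self_mul_conjTranspose W
  -- The pseudo-inverse of `√ω`: as `0⁻¹ = 0`, it vanishes on the kernel, and `S * W` is a partial
  -- isometry.
  set S := cfc (fun x : ℝ => (√x)⁻¹) ω with hS
  have hSh : Sᴴ = S := cfc_matrix_isHermitian _ _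
  have hid := cfc_matrix_id hp.1
  have key : ∀ x : ℝ, 0 ≤ x → (√x)⁻¹ * x = √x := fun x hx => by
    rcases hx.eq_or_lt with rfl | h
    · simp
    · have h1 := Real.mul_self_sqrt hx
      have h2 := (Real.sqrt_pos.2 h).ne'
      field_simp; linarith
  have h1 : S * ω = opSqrt ω := by
    conv_lhs => rw [← hid, hS, cfc_matrix_mul]
    exact cfc_matrix_congr hp key
  have h2 : ω * S = opSqrt ω := by
    have := congrArg Matrix.conjTranspose h1
    rwa [Matrix.conjTranspose_mul, hSh, hp.1.eq, opSqrt_isHermitian] at this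
  have h3 : opSqrt ω * S * ω = ω := by
    rw [Matrix.mul_assoc, h1, opSqrt_mul_self hp]
  have h4 : opSqrt ω * S * S = S := by
    rw [opSqrt, hS, cfc_matrix_mul, cfc_matrix_mul]
    refine cfc_matrix_congr hp fun x _ => ?_
    by_cases h : √x = 0 <;> simp [h]
  -- `√ω S` projects onto the support of `ω = W Wᴴ`, which contains the range of `W`.
  have h5 : (1 - opSqrt ω * S) * W = 0 := by
    rw [← Matrix.self_mul_conjTranspose_eq_zero, Matrix.conjTranspose_mul, Matrix.mul_assoc,
      ← Matrix.mul_assoc W, ← hω, ← Matrix.mul_assoc, Matrix.sub_mul, h3]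
    simp
  refine ⟨S * W, ?_, ?_, ?_, ?_⟩
  · rw [Matrix.sub_mul, Matrix.one_mul, sub_eq_zero] at h5
    rw [← Matrix.mul_assoc]; exact h5
  · rw [Matrix.mul_assoc, ← hω, h1]
  · refine isContr_of_conjTranspose_mul_self_idem ?_
    have : (S * W)ᴴ * (S * W) * ((S * W)ᴴ * (S * W)) = Wᴴ * (S * (S * (W * Wᴴ) * S) * S * W) := by
      simp only [Matrix.conjTranspose_mul, hSh, Matrix.mul_assoc]
    rw [this, ← hω, h1, Matrix.mul_assoc S, h4, Matrix.conjTranspose_mul, hSh]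
    simp only [Matrix.mul_assoc]
  · refine isContr_of_conjTranspose_mul_self_idem ?_
    have : S * W * (S * W)ᴴ = opSqrt ω * S := by
      rw [← h1, hω, Matrix.conjTranspose_mul, hSh]; simp only [Matrix.mul_assoc]
    rw [Matrix.conjTranspose_conjTranspose, this]
    rw [opSqrt, hS, cfc_matrix_mul, cfc_matrix_mul]
    refine cfc_matrix_congr hp fun x _ => ?_
    by_cases h : √x = 0 <;> simp [h]

/-- `‖A‖₁` is attained at a contraction. -/
lemma exists_contr_traceNorm (A : Matrix m m ℂ) :
    ∃ U : Matrix m m ℂ, IsContr U ∧ IsContr Uᴴ ∧ A = Uᴴ * opSqrt (Aᴴ * A) ∧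
      traceNorm A = (U * A).trace.re := by
  obtain ⟨U, h1, h2, h3, h4⟩ := exists_polar Aᴴ
  rw [Matrix.conjTranspose_conjTranspose] at h1 h2
  refine ⟨U, h3, h4, ?_, by rw [h2, traceNorm]⟩
  have := congrArg Matrix.conjTranspose h1
  rwa [Matrix.conjTranspose_mul, Matrix.conjTranspose_conjTranspose, opSqrt_isHermitian] at this

/-- Cauchy–Schwarz for `√H` and `D √H`. -/
lemma IsContr.re_trace_mul_le_trace {D H : Matrix m m ℂ} (hD : IsContr D) (hH : H.PosSemidef) :
    (D * H).trace.re ≤ H.trace.re := by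
  have hs := opSqrt_mul_self hH
  have hh := opSqrt_isHermitian H
  set K := opSqrt H
  have h1 : (D * H).trace = (Kᴴ * (D * K)).trace := by
    rw [hh, Matrix.trace_mul_comm K, Matrix.mul_assoc, hs]
  have h2 : H.trace.re = hsNorm K ^ 2 := by rw [hsNorm_sq, hh, hs]
  rw [h1, h2, sq]
  exact (re_trace_conjTranspose_mul_le _ _).trans
    (mul_le_mul_of_nonneg_left (hD.hsNorm_mul_le K) (hsNorm_nonneg K))

lemma re_trace_mul_le_traceNorm {C : Matrix m m ℂ} (hC : IsContr C) (A : Matrix m m ℂ) :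
    (C * A).trace.re ≤ traceNorm A := by
  obtain ⟨U, -, h4, h, -⟩ := exists_contr_traceNorm A
  have hp : (opSqrt (Aᴴ * A)).PosSemidef :=
    cfc_matrix_posSemidef (Matrix.posSemidef_conjTranspose_mul_self A) fun x _ => Real.sqrt_nonneg x
  conv_lhs => rw [h, ← Matrix.mul_assoc]
  exact (hC.mul h4).re_trace_mul_le_trace hp

/-- The overlap of two purifications is a lower bound for the fidelity. -/
lemma re_trace_le_traceNorm_sqrt_mul_sqrt [DecidableEq n] (W V : Matrix m n ℂ) :
    (Wᴴ * V).trace.re ≤ traceNorm (opSqrt (W * Wᴴ) * opSqrt (V * Vᴴ)) := by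
  obtain ⟨U, h1, -, h3, h4⟩ := exists_polar W
  obtain ⟨U', h1', -, h3', h4'⟩ := exists_polar V
  have hc : IsContr (U' * Uᴴ) := h3'.mul h4
  refine le_trans (le_of_eq ?_) (re_trace_mul_le_traceNorm hc _)
  have hW := congrArg Matrix.conjTranspose h1
  rw [Matrix.conjTranspose_mul, opSqrt_isHermitian] at hW
  conv_lhs => rw [hW, h1']
  rw [← Matrix.mul_assoc, Matrix.trace_mul_comm]
  simp only [Matrix.mul_assoc]

/-- If the fidelity is large, a test `N` that almost preserves `ρ` cannot annihilate `ω`. -/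
lemma traceNorm_sqrt_mul_sqrt_le {ω ρ : Matrix m m ℂ} (hω : ω.PosSemidef) (hρ : ρ.PosSemidef)
    (hω1 : ω.trace.re ≤ 1) (hρ1 : ρ.trace.re ≤ 1) (N : Matrix m m ℂ) :
    traceNorm (opSqrt ω * opSqrt ρ) ≤
      √((Nᴴ * ω * N).trace.re) + hsNorm (opSqrt ρ - N * opSqrt ρ) := by
  obtain ⟨U, h3, h4, -, h⟩ := exists_contr_traceNorm (opSqrt ω * opSqrt ρ)
  have hωs := opSqrt_mul_self hω
  have hρs := opSqrt_mul_self hρ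
  have hωh := opSqrt_isHermitian ω
  have hρh := opSqrt_isHermitian ρ
  set a := opSqrt ω
  set b := opSqrt ρ
  have ha : hsNorm a ≤ 1 := by
    have : hsNorm a ^ 2 ≤ 1 := by rw [hsNorm_sq, hωh, hωs]; exact hω1
    nlinarith [hsNorm_nonneg a]
  have hb : hsNorm b ≤ 1 := by
    have : hsNorm b ^ 2 ≤ 1 := by rw [hsNorm_sq, hρh, hρs]; exact hρ1
    nlinarith [hsNorm_nonneg b]
  -- Split `b = (b - N b) + N b`; Cauchy–Schwarz on the two parts gives the two summands of the
  -- bound.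
  have hsplit : (U * (a * b)).trace.re =
      ((Uᴴ)ᴴ * (a * (b - N * b))).trace.re + ((Nᴴ * a)ᴴ * (b * U)).trace.re := by
    have : ((Nᴴ * a)ᴴ * (b * U)).trace = (U * (a * N * b)).trace := by
      rw [Matrix.conjTranspose_mul, Matrix.conjTranspose_conjTranspose, hωh,
        ← Matrix.mul_assoc, Matrix.trace_mul_comm]
    rw [this, ← Complex.add_re, ← Matrix.trace_add, Matrix.conjTranspose_conjTranspose,
      ← Matrix.mul_add]
    congr 3
    simp only [Matrix.mul_sub, Matrix.mul_assoc, sub_add_cancel]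
  have e1 : ((Uᴴ)ᴴ * (a * (b - N * b))).trace.re ≤ hsNorm (b - N * b) := by
    have : (Uᴴ)ᴴ * (a * (b - N * b)) = (a * Uᴴ)ᴴ * (b - N * b) := by
      rw [Matrix.conjTranspose_mul, hωh, Matrix.mul_assoc]
    rw [this]
    refine (re_trace_conjTranspose_mul_le _ _).trans ?_
    refine mul_le_of_le_one_left (hsNorm_nonneg _) ?_
    rw [← hsNorm_conjTranspose, Matrix.conjTranspose_mul, hωh, Matrix.conjTranspose_conjTranspose]
    exact (h3.hsNorm_mul_le a).trans ha
  have e2 : ((Nᴴ * a)ᴴ * (b * U)).trace.re ≤ √((Nᴴ * ω * N).trace.re) := by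
    refine (re_trace_conjTranspose_mul_le _ _).trans ?_
    refine (mul_le_of_le_one_right (hsNorm_nonneg _) ?_).trans (le_of_eq ?_)
    · rw [← hsNorm_conjTranspose, Matrix.conjTranspose_mul, hρh]
      exact (h4.hsNorm_mul_le b).trans hb
    · rw [← Real.sqrt_sq (hsNorm_nonneg (Nᴴ * a)), hsNorm_sq', Matrix.conjTranspose_mul, hωh,
        Matrix.conjTranspose_conjTranspose, Matrix.mul_assoc, ← Matrix.mul_assoc a, hωs,
        ← Matrix.mul_assoc]
  rw [h, hsplit]
  linarith

/-- Gentle measurement: two projections that `B Bᴴ` passes almost surely barely change `B`. -/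
lemma hsNorm_sub_mul_mul_le {P Q : Matrix m m ℂ} (hP : IsStarProjection P)
    (hQ : IsStarProjection Q) {B : Matrix m n ℂ} (hB : (B * Bᴴ).trace.re = 1) :
    hsNorm (B - P * Q * B) ≤
      √(1 - (P * (B * Bᴴ)).trace.re) + √(1 - (Q * (B * Bᴴ)).trace.re) := by
  -- Pythagoras: `‖B - R B‖² = tr B Bᴴ - tr R B Bᴴ` for a projection `R`.
  have key : ∀ R : Matrix m m ℂ, IsStarProjection R →
      hsNorm (B - R * B) = √(1 - (R * (B * Bᴴ)).trace.re) := fun R hR => by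
    rw [← Real.sqrt_sq (hsNorm_nonneg (B - R * B)), hsNorm_sq, ← hB, ← Complex.sub_re]
    have h1 : Rᴴ = R := hR.isSelfAdjoint.star_eq
    have h2 : R * R = R := hR.isIdempotentElem.eq
    congr 2
    have : (B - R * B)ᴴ * (B - R * B) = Bᴴ * B - Bᴴ * (R * B) := by
      simp only [Matrix.conjTranspose_sub, Matrix.conjTranspose_mul, h1, Matrix.sub_mul,
        Matrix.mul_sub, Matrix.mul_assoc]
      rw [← Matrix.mul_assoc R R, h2]
      abel
    rw [this, Matrix.trace_sub, Matrix.trace_mul_comm, Matrix.trace_mul_comm Bᴴ, Matrix.mul_assoc]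
  have : B - P * Q * B = (B - P * B) + P * (B - Q * B) := by
    simp only [Matrix.mul_sub, Matrix.mul_assoc]; abel
  rw [this]
  refine (hsNorm_add_le _ _).trans (add_le_add (key P hP).le ?_)
  exact ((isContr_of_isStarProjection hP).hsNorm_mul_le _).trans (key Q hQ).le

end FunctionalCalculus

/-! ### Tensor powers, partial trace and amplification. -/

section TensorPowers

variable {ι κ r e : Type*} [Fintype ι] [Fintype κ] [Fintype r] [Fintype e]

lemma prod_sum_fin {n : ℕ} (F : Fin n → ι → ℂ) :
    ∏ k, ∑ a, F k a = ∑ f : Fin n → ι, ∏ k, F k (f k) := by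
  classical
  rw [Finset.prod_univ_sum, Fintype.piFinset_univ]

/-- `A^{⊗n}` for a rectangular matrix. -/
def kronPow (A : Matrix κ ι ℂ) (n : ℕ) : Matrix (Fin n → κ) (Fin n → ι) ℂ :=
  Matrix.of fun f g => ∏ k, A (f k) (g k)

lemma kronPow_mul (A : Matrix κ ι ℂ) (B : Matrix ι r ℂ) (n : ℕ) :
    kronPow (A * B) n = kronPow A n * kronPow B n := by
  ext f g
  simp only [kronPow, Matrix.of_apply, Matrix.mul_apply, prod_sum_fin, Finset.prod_mul_distrib]

lemma kronPow_conjTranspose (A : Matrix κ ι ℂ) (n : ℕ) : kronPow Aᴴ n = (kronPow A n)ᴴ := by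
  ext f g
  simp [kronPow, Matrix.conjTranspose_apply]

lemma tensorPow_mul (A B : Matrix ι ι ℂ) (n : ℕ) :
    tensorPow (A * B) n = tensorPow A n * tensorPow B n := kronPow_mul A B n

lemma tensorPow_conjTranspose (A : Matrix ι ι ℂ) (n : ℕ) :
    tensorPow Aᴴ n = (tensorPow A n)ᴴ := kronPow_conjTranspose A n

lemma trace_tensorPow (A : Matrix ι ι ℂ) (n : ℕ) : (tensorPow A n).trace = A.trace ^ n := by
  simp only [Matrix.trace, Matrix.diag, tensorPow, Matrix.of_apply]
  rw [← prod_sum_fin fun _ a => A a a]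
  simp

lemma tensorPow_diagonal [DecidableEq ι] (d : ι → ℂ) (n : ℕ) :
    tensorPow (Matrix.diagonal d) n = Matrix.diagonal fun f => ∏ k, d (f k) := by
  ext f g
  by_cases h : f = g
  · subst h; simp [tensorPow]
  · obtain ⟨k, hk⟩ := Function.ne_iff.1 h
    rw [Matrix.diagonal_apply_ne _ h]
    exact Finset.prod_eq_zero (Finset.mem_univ k) (Matrix.diagonal_apply_ne _ hk)

lemma tensorPow_one [DecidableEq ι] (n : ℕ) : tensorPow (1 : Matrix ι ι ℂ) n = 1 := by
  rw [← Matrix.diagonal_one, tensorPow_diagonal]; simp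

lemma tensorPow_posSemidef {A : Matrix ι ι ℂ} (hA : A.PosSemidef) (n : ℕ) :
    (tensorPow A n).PosSemidef := by
  classical
  rw [← opSqrt_mul_self hA, tensorPow_mul]
  nth_rw 1 [← opSqrt_isHermitian]
  rw [tensorPow_conjTranspose]
  exact Matrix.posSemidef_conjTranspose_mul_self _

lemma ptraceRight_tensorPow₂ (M : Matrix (ι × r) (ι × r) ℂ) (n : ℕ) :
    ptraceRight (tensorPow₂ M n) = tensorPow (ptraceRight M) n := by
  ext f g
  simp [ptraceRight, tensorPow, tensorPow₂, prod_sum_fin]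

lemma tensorPow₂_ketBra (ψ : ι × r → ℂ) (n : ℕ) :
    tensorPow₂ (ketBra ψ) n = ketBra fun p => ∏ k, ψ (p.1 k, p.2 k) := by
  ext p q
  simp [tensorPow₂, ketBra, Matrix.vecMulVec_apply, Finset.prod_mul_distrib]

lemma trace_ptraceRight (M : Matrix (ι × r) (ι × r) ℂ) : (ptraceRight M).trace = M.trace := by
  simp [Matrix.trace, ptraceRight, Fintype.sum_prod_type]

lemma ptraceRight_posSemidef {M : Matrix (ι × r) (ι × r) ℂ} (hM : M.PosSemidef) :
    (ptraceRight M).PosSemidef := by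
  have : ptraceRight M = ∑ k, M.submatrix (fun i => (i, k)) (fun i => (i, k)) := by
    ext i j
    simp [ptraceRight, Matrix.sum_apply]
  rw [this]
  exact Matrix.posSemidef_sum _ fun k _ => hM.submatrix _

lemma ketBra_posSemidef (ψ : ι → ℂ) : (ketBra ψ).PosSemidef :=
  Matrix.posSemidef_vecMulVec_self_star ψ

lemma trace_ketBra {ψ : ι → ℂ} (hψ : IsUnitKet ψ) : (ketBra ψ).trace = 1 := by
  rw [ketBra, Matrix.trace_vecMulVec, dotProduct]
  have : ((∑ i, ‖ψ i‖ ^ 2 : ℝ) : ℂ) = 1 := by rw [hψ]; simp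
  rw [← this]
  push_cast
  exact Finset.sum_congr rfl fun i _ => by rw [Pi.star_apply, ← Complex.mul_conj']; rfl

/-- `A ⊗ 1`. -/
def ampl (r : Type*) [DecidableEq r] (A : Matrix κ ι ℂ) : Matrix (κ × r) (ι × r) ℂ :=
  A ⊗ₖ (1 : Matrix r r ℂ)

variable [DecidableEq r]

lemma ampl_mul (A : Matrix κ ι ℂ) (B : Matrix ι e ℂ) : ampl r (A * B) = ampl r A * ampl r B := by
  rw [ampl, ampl, ampl, ← Matrix.mul_kronecker_mul, Matrix.one_mul]

lemma ampl_conjTranspose (A : Matrix κ ι ℂ) : ampl r Aᴴ = (ampl r A)ᴴ := by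
  rw [ampl, ampl, Matrix.conjTranspose_kronecker, Matrix.conjTranspose_one]

lemma ampl_isStarProjection [DecidableEq ι] {P : Matrix ι ι ℂ} (hP : IsStarProjection P) :
    IsStarProjection (ampl r P) where
  isIdempotentElem := by
    rw [IsIdempotentElem, ← ampl_mul, hP.isIdempotentElem.eq]
  isSelfAdjoint := by
    rw [IsSelfAdjoint, Matrix.star_eq_conjTranspose, ← ampl_conjTranspose,
      ← Matrix.star_eq_conjTranspose, hP.isSelfAdjoint.star_eq]

lemma ampl_mul_apply (A : Matrix κ ι ℂ) (M : Matrix (ι × r) e ℂ) (x : κ) (s : r) (j : e) :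
    (ampl r A * M) (x, s) j = ∑ i, A x i * M (i, s) j := by
  simp [ampl, Matrix.mul_apply, Fintype.sum_prod_type, Matrix.kroneckerMap_apply,
    Matrix.one_apply]

lemma mul_ampl_apply (A : Matrix ι κ ℂ) (M : Matrix e (ι × r) ℂ) (x : κ) (s : r) (j : e) :
    (M * ampl r A) j (x, s) = ∑ i, M j (i, s) * A i x := by
  simp [ampl, Matrix.mul_apply, Fintype.sum_prod_type, Matrix.kroneckerMap_apply,
    Matrix.one_apply]

lemma ptraceRight_ampl_mul (A : Matrix ι ι ℂ) (M : Matrix (ι × r) (ι × r) ℂ) :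
    ptraceRight (ampl r A * M) = A * ptraceRight M := by
  ext i j
  simp only [ptraceRight, Matrix.of_apply, ampl_mul_apply]
  simp only [Matrix.mul_apply, Matrix.of_apply, Finset.mul_sum]
  exact Finset.sum_comm

lemma ptraceRight_mul_ampl (A : Matrix ι ι ℂ) (M : Matrix (ι × r) (ι × r) ℂ) :
    ptraceRight (M * ampl r A) = ptraceRight M * A := by
  ext i j
  simp only [ptraceRight, Matrix.of_apply, mul_ampl_apply]
  simp only [Matrix.mul_apply, Matrix.of_apply, Finset.sum_mul]
  exact Finset.sum_comm

/-- Exchange the environment and the reference. -/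
def reshuffle (M : Matrix (κ × e) r ℂ) : Matrix (κ × r) e ℂ := Matrix.of fun p s => M (p.1, s) p.2

/-- Entries are only permuted, so overlaps of dilated kets do not depend on which of environment and
reference indexes the columns. -/
lemma trace_reshuffle (M N : Matrix (κ × e) r ℂ) :
    ((reshuffle M)ᴴ * reshuffle N).trace = (Mᴴ * N).trace := by
  simp only [Matrix.trace, Matrix.diag, Matrix.mul_apply, reshuffle, Matrix.of_apply,
    Matrix.conjTranspose_apply, Fintype.sum_prod_type]
  rw [Finset.sum_comm]
  calc _ = ∑ x, ∑ t : r, ∑ s : e, star (M (x, s) t) * N (x, s) t := by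
        exact Finset.sum_congr rfl fun x _ => Finset.sum_comm
    _ = ∑ t : r, ∑ x, ∑ s : e, star (M (x, s) t) * N (x, s) t := Finset.sum_comm

lemma ampl_mul_reshuffle [DecidableEq e] (A : Matrix κ κ ℂ) (M : Matrix (κ × e) r ℂ) :
    ampl r A * reshuffle M = reshuffle (ampl e A * M) := by
  ext ⟨x, t⟩ s
  simp only [reshuffle, Matrix.of_apply, ampl_mul_apply]

end TensorPowers

/-! ### Stinespring operators and tensor powers of channels. -/

section Stinespring

variable {ι κ r e : Type*} [Fintype ι] [Fintype κ] [Fintype r] [Fintype e]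
  [DecidableEq ι] [DecidableEq κ] [DecidableEq r] [DecidableEq e]

/-- `V` is a Stinespring operator of `E`. -/
def IsStinespring (E : Matrix ι ι ℂ →ₗ[ℂ] Matrix κ κ ℂ) (V : Matrix (κ × e) ι ℂ) : Prop :=
  ∀ A, E A = ptraceRight (V * A * Vᴴ)

lemma map_eq_sum_single (E : Matrix ι ι ℂ →ₗ[ℂ] Matrix κ κ ℂ) (A : Matrix ι ι ℂ) (x y : κ) :
    E A x y = ∑ i, ∑ j, A i j * E (Matrix.single i j 1) x y := by
  conv_lhs => rw [Matrix.matrix_eq_sum_single A]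
  simp only [map_sum, Matrix.sum_apply]
  refine Finset.sum_congr rfl fun i _ => Finset.sum_congr rfl fun j _ => ?_
  have : Matrix.single i j (A i j) = A i j • Matrix.single i j (1 : ℂ) := by
    rw [Matrix.smul_single]; simp
  rw [this, map_smul, Matrix.smul_apply, smul_eq_mul]

lemma stinespring_apply (V : Matrix (κ × e) ι ℂ) (A : Matrix ι ι ℂ) (x y : κ) :
    ptraceRight (V * A * Vᴴ) x y =
      ∑ i, ∑ j, A i j * ∑ s, V (x, s) i * star (V (y, s) j) := by
  simp only [ptraceRight, Matrix.of_apply, Matrix.mul_apply, Matrix.conjTranspose_apply,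
    Finset.sum_mul, Finset.mul_sum]
  rw [Finset.sum_comm]
  simp_rw [Finset.sum_comm (s := (Finset.univ : Finset e))]
  rw [Finset.sum_comm]
  refine Finset.sum_congr rfl fun i _ => Finset.sum_congr rfl fun j _ =>
    Finset.sum_congr rfl fun s _ => by ring

lemma isStinespring_of_single {E : Matrix ι ι ℂ →ₗ[ℂ] Matrix κ κ ℂ} {V : Matrix (κ × e) ι ℂ}
    (h : ∀ i j x y, E (Matrix.single i j 1) x y = ∑ s, V (x, s) i * star (V (y, s) j)) :
    IsStinespring E V := fun A => by
  ext x y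
  rw [map_eq_sum_single, stinespring_apply]
  simp only [h]

lemma IsStinespring.single {E : Matrix ι ι ℂ →ₗ[ℂ] Matrix κ κ ℂ} {V : Matrix (κ × e) ι ℂ}
    (h : IsStinespring E V) (i j : ι) (x y : κ) :
    E (Matrix.single i j 1) x y = ∑ s, V (x, s) i * star (V (y, s) j) := by
  rw [h, stinespring_apply, Finset.sum_eq_single i, Finset.sum_eq_single j]
  · simp
  · intro b _ hb; simp [hb.symm]
  · simp
  · intro b _ hb; simp [hb.symm]
  · simp

lemma choi_apply (E : Matrix ι ι ℂ →ₗ[ℂ] Matrix κ κ ℂ) (x y : κ) (i j : ι) :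
    applyLeft E (ketBra (maxEntKet ι)) (x, i) (y, j) = E (Matrix.single i j 1) x y := by
  simp only [applyLeft, Matrix.of_apply]
  refine congrFun (congrFun (congrArg E ?_) x) y
  ext a b
  simp only [ketBra, Matrix.vecMulVec_apply, maxEntKet, Matrix.of_apply, Pi.star_apply,
    Matrix.single_apply]
  by_cases h1 : i = a <;> by_cases h2 : j = b <;>
    simp [h1, h2, eq_comm (a := a), eq_comm (a := b)]

/-- The positive Choi matrix factors as `Yᴴ Y`; the conjugated rows of `Y` are Kraus operators, so
the row index of `Y` serves as environment. -/
lemma exists_stinespring {E : Matrix ι ι ℂ →ₗ[ℂ] Matrix κ κ ℂ} (hE : IsCompletelyPositive E) :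
    ∃ V : Matrix (κ × (κ × ι)) ι ℂ, IsStinespring E V := by
  have hY := opSqrt_mul_self hE
  nth_rw 1 [← opSqrt_isHermitian] at hY
  set Y := opSqrt (applyLeft E (ketBra (maxEntKet ι)))
  refine ⟨Matrix.of fun p i => star (Y p.2 (p.1, i)), isStinespring_of_single fun i j x y => ?_⟩
  rw [← choi_apply, ← hY, Matrix.mul_apply]
  simp [Matrix.conjTranspose_apply]

/-- The matrix of a bipartite ket. -/
def ketMatrix (ψ : ι × r → ℂ) : Matrix ι r ℂ := Matrix.of fun i s => ψ (i, s)

lemma ptraceRight_ketBra (ψ : ι × r → ℂ) :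
    ptraceRight (ketBra ψ) = ketMatrix ψ * (ketMatrix ψ)ᴴ := by
  ext i j
  simp [ptraceRight, ketBra, ketMatrix, Matrix.mul_apply, Matrix.vecMulVec_apply]

/-- Exhibits the dilated ket as a purification of the output on system and reference, the
environment being the column index. -/
lemma IsStinespring.applyLeft_ketBra {E : Matrix ι ι ℂ →ₗ[ℂ] Matrix κ κ ℂ}
    {V : Matrix (κ × e) ι ℂ} (h : IsStinespring E V) (ψ : ι × r → ℂ) :
    applyLeft E (ketBra ψ) =
      reshuffle (V * ketMatrix ψ) * (reshuffle (V * ketMatrix ψ))ᴴ := by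
  ext ⟨x, s⟩ ⟨y, t⟩
  simp only [applyLeft, Matrix.of_apply]
  rw [h, stinespring_apply]
  simp only [ketBra, Matrix.vecMulVec_apply, reshuffle, Matrix.of_apply, Matrix.mul_apply,
    Matrix.conjTranspose_apply, ketMatrix, Pi.star_apply, star_sum, star_mul', Finset.mul_sum,
    Finset.sum_mul]
  simp_rw [Finset.sum_comm (s := (Finset.univ : Finset e))]
  rw [Finset.sum_comm]
  refine Finset.sum_congr rfl fun i _ => Finset.sum_congr rfl fun j _ =>
    Finset.sum_congr rfl fun s _ => by ring

lemma IsStinespring.isCompletelyPositive {E : Matrix ι ι ℂ →ₗ[ℂ] Matrix κ κ ℂ}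
    {V : Matrix (κ × e) ι ℂ} (h : IsStinespring E V) : IsCompletelyPositive E := by
  rw [IsCompletelyPositive, h.applyLeft_ketBra]
  exact Matrix.posSemidef_self_mul_conjTranspose _

lemma IsStinespring.posSemidef {E : Matrix ι ι ℂ →ₗ[ℂ] Matrix κ κ ℂ}
    {V : Matrix (κ × e) ι ℂ} (h : IsStinespring E V) {A : Matrix ι ι ℂ} (hA : A.PosSemidef) :
    (E A).PosSemidef := by
  rw [h]
  exact ptraceRight_posSemidef (hA.mul_mul_conjTranspose_same V)

lemma IsStinespring.mono {E : Matrix ι ι ℂ →ₗ[ℂ] Matrix κ κ ℂ}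
    {V : Matrix (κ × e) ι ℂ} (h : IsStinespring E V) {A B : Matrix ι ι ℂ} (hA : A ≤ B) :
    E A ≤ E B := by
  rw [Matrix.le_iff, ← map_sub]
  exact h.posSemidef (Matrix.le_iff.1 hA)

lemma IsStinespring.trace {E : Matrix ι ι ℂ →ₗ[ℂ] Matrix κ κ ℂ}
    {V : Matrix (κ × e) ι ℂ} (h : IsStinespring E V) (A : Matrix ι ι ℂ) :
    (E A).trace = (V * A * Vᴴ).trace := by
  rw [h, trace_ptraceRight]

lemma IsStinespring.hsNorm_sq {E : Matrix ι ι ℂ →ₗ[ℂ] Matrix κ κ ℂ}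
    {V : Matrix (κ × e) ι ℂ} (h : IsStinespring E V) (C : Matrix ι r ℂ) :
    hsNorm (V * C) ^ 2 = (E (C * Cᴴ)).trace.re := by
  rw [h.trace, hsNorm_sq', Matrix.conjTranspose_mul]
  simp only [Matrix.mul_assoc]

/-- An explicit dilation of the truncated map; complete positivity, trace decrease and fidelity are
all read off from it. -/
lemma IsStinespring.sandwich {E : Matrix ι ι ℂ →ₗ[ℂ] Matrix κ κ ℂ}
    {V : Matrix (κ × e) ι ℂ} (h : IsStinespring E V) {S Q : Matrix κ κ ℂ} {P R : Matrix ι ι ℂ}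
    (hS : Sᴴ = S) (hQ : Qᴴ = Q) (hP : Pᴴ = P) (hR : Rᴴ = R) :
    IsStinespring (sandwich E S Q P R) (ampl e (S * Q) * V * (R * P)) := fun A => by
  have : ampl e (S * Q) * V * (R * P) * A * (ampl e (S * Q) * V * (R * P))ᴴ =
      ampl e (S * Q) * ((V * (R * P * A * P * R) * Vᴴ) * ampl e (Q * S)) := by
    rw [Matrix.conjTranspose_mul, Matrix.conjTranspose_mul (ampl e (S * Q)), ← ampl_conjTranspose,
      Matrix.conjTranspose_mul, Matrix.conjTranspose_mul, hS, hQ, hP, hR]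
    simp only [Matrix.mul_assoc]
  rw [this, ptraceRight_ampl_mul, ptraceRight_mul_ampl, ← h]
  simp [QInfo.sandwich, Matrix.mul_assoc]

/-- The tensor power of a Stinespring operator. -/
def stinespringPow (V : Matrix (κ × e) ι ℂ) (n : ℕ) :
    Matrix ((Fin n → κ) × (Fin n → e)) (Fin n → ι) ℂ :=
  Matrix.of fun p f => ∏ k, V (p.1 k, p.2 k) (f k)

lemma tensorPowMap_single (E : Matrix ι ι ℂ →ₗ[ℂ] Matrix κ κ ℂ) (n : ℕ) (a b : Fin n → ι)
    (f g : Fin n → κ) : tensorPowMap E n (Matrix.single a b 1) f g =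
      ∏ k, E (Matrix.single (a k) (b k) 1) (f k) (g k) := by
  simp only [tensorPowMap, LinearMap.coe_mk, AddHom.coe_mk, Matrix.of_apply]
  rw [Finset.sum_eq_single a, Finset.sum_eq_single b]
  · simp
  · intro c _ hc; simp [hc.symm]
  · simp
  · intro c _ hc; simp [hc.symm]
  · simp

lemma IsStinespring.tensorPowMap {E : Matrix ι ι ℂ →ₗ[ℂ] Matrix κ κ ℂ}
    {V : Matrix (κ × e) ι ℂ} (h : IsStinespring E V) (n : ℕ) :
    IsStinespring (tensorPowMap E n) (stinespringPow V n) := by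
  refine isStinespring_of_single fun a b f g => ?_
  rw [tensorPowMap_single]
  simp only [h.single, prod_sum_fin, stinespringPow, Matrix.of_apply, Finset.prod_mul_distrib,
    star_prod]

lemma tensorPowMap_prod (E : Matrix ι ι ℂ →ₗ[ℂ] Matrix κ κ ℂ) (n : ℕ)
    (A : Fin n → Matrix ι ι ℂ) (f g : Fin n → κ) :
    tensorPowMap E n (Matrix.of fun a b => ∏ k, A k (a k) (b k)) f g =
      ∏ k, E (A k) (f k) (g k) := by
  simp only [map_eq_sum_single E (A _), prod_sum_fin, tensorPowMap, LinearMap.coe_mk,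
    AddHom.coe_mk, Matrix.of_apply, Finset.prod_mul_distrib]

lemma tensorPowMap_tensorPow (E : Matrix ι ι ℂ →ₗ[ℂ] Matrix κ κ ℂ) (n : ℕ)
    (A : Matrix ι ι ℂ) : tensorPowMap E n (tensorPow A n) = tensorPow (E A) n := by
  ext f g
  exact tensorPowMap_prod E n (fun _ => A) f g

lemma tensorPow₂_applyLeft (E : Matrix ι ι ℂ →ₗ[ℂ] Matrix κ κ ℂ) (n : ℕ)
    (M : Matrix (ι × r) (ι × r) ℂ) :
    tensorPow₂ (applyLeft E M) n = applyLeft (tensorPowMap E n) (tensorPow₂ M n) := by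
  ext p q
  exact (tensorPowMap_prod E n
    (fun k => Matrix.of fun i j => M (i, p.2 k) (j, q.2 k)) p.1 q.1).symm

lemma ptraceRight_applyLeft (E : Matrix ι ι ℂ →ₗ[ℂ] Matrix κ κ ℂ)
    (M : Matrix (ι × r) (ι × r) ℂ) : ptraceRight (applyLeft E M) = E (ptraceRight M) := by
  have : ptraceRight M = ∑ k, Matrix.of fun i j => M (i, k) (j, k) := by
    ext i j
    simp [ptraceRight, Matrix.sum_apply]
  rw [this, map_sum]
  ext x y
  simp [ptraceRight, applyLeft, Matrix.sum_apply]

/-- On matrix units the trace factorizes over the copies; linearity does the rest. -/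
lemma tensorPowMap_isTracePreserving {E : Matrix ι ι ℂ →ₗ[ℂ] Matrix κ κ ℂ}
    (hE : IsTracePreserving E) (n : ℕ) : IsTracePreserving (tensorPowMap E n) := fun A => by
  have hs : ∀ a b : Fin n → ι, (tensorPowMap E n (Matrix.single a b 1)).trace =
      (Matrix.single a b (1 : ℂ)).trace := fun a b => by
    have h1 : ∀ i j : ι, ∑ x, E (Matrix.single i j 1) x x = if i = j then 1 else 0 := fun i j => by
      have := hE (Matrix.single i j 1)
      rw [Matrix.trace] at this
      simp only [Matrix.diag] at this
      rw [this]
      by_cases h : i = j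
      · subst h; simp
      · simp [h, Matrix.trace_single_eq_of_ne]
    simp only [Matrix.trace, Matrix.diag, tensorPowMap_single]
    rw [← prod_sum_fin fun k x => E (Matrix.single (a k) (b k) 1) x x]
    simp only [h1]
    by_cases h : a = b
    · subst h; simp [Matrix.single_apply]
    · obtain ⟨k, hk⟩ := Function.ne_iff.1 h
      rw [Finset.prod_eq_zero (Finset.mem_univ k) (by simp [hk])]
      symm
      exact Matrix.trace_single_eq_of_ne a b 1 h
  have : (Matrix.traceLinearMap _ ℂ ℂ) ∘ₗ tensorPowMap E n = Matrix.traceLinearMap _ ℂ ℂ := by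
    refine Matrix.ext_linearMap ℂ fun a b => ?_
    ext
    simpa using hs a b
  exact LinearMap.congr_fun this A

end Stinespring

/-! ### Exponential concentration of empirical means. -/

section LargeDeviations

variable {ι : Type*} [Fintype ι]

lemma prod_sum_fin_real {n : ℕ} (F : Fin n → ι → ℝ) :
    ∏ k, ∑ a, F k a = ∑ f : Fin n → ι, ∏ k, F k (f k) := by
  classical
  rw [Finset.prod_univ_sum, Fintype.piFinset_univ]

/-- One-sided Chernoff bound. -/
lemma exists_chernoff {p : ι → ℝ} (hp : ∀ i, 0 ≤ p i) (hp1 : ∑ i, p i = 1) (x : ι → ℝ)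
    {c : ℝ} (hc : ∑ i, p i * x i < c) : ∃ η : ℝ, 0 < η ∧ ∀ n : ℕ,
      ∑ f : Fin n → ι, (if n * c < ∑ k, x (f k) then (1 : ℝ) else 0) * ∏ k, p (f k) ≤
        Real.exp (-(n * η)) := by
  -- The moment generating function of `x - c`. It is `1` at `0` with negative derivative there, so
  -- it drops below `1` at some `s > 0`; the rate is `-log (g s)`.
  set g : ℝ → ℝ := fun s => ∑ i, p i * Real.exp (s * (x i - c)) with hg
  have hg0 : g 0 = 1 := by simp [hg, hp1]
  have hd : HasDerivAt g (∑ i, p i * (x i - c)) 0 := by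
    have : ∀ i ∈ (Finset.univ : Finset ι), HasDerivAt (fun s => p i * Real.exp (s * (x i - c)))
        (p i * (x i - c)) 0 := fun i _ => by
      have h := (((hasDerivAt_id (0 : ℝ)).mul_const (x i - c)).exp).const_mul (p i)
      simpa using h
    exact (HasDerivAt.fun_sum this).congr_deriv rfl
  have hneg : ∑ i, p i * (x i - c) < 0 := by
    simp only [mul_sub, Finset.sum_sub_distrib, ← Finset.sum_mul, hp1, one_mul]
    linarith
  obtain ⟨s, hs, hgs⟩ : ∃ s : ℝ, 0 < s ∧ g s < 1 := by
    have h1 := (hasDerivAt_iff_tendsto_slope_zero.1 hd).mono_left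
      (nhdsWithin_mono (0 : ℝ) (fun y (hy : y ∈ Set.Ioi 0) => ne_of_gt hy))
    obtain ⟨s, h2, h3⟩ := ((h1.eventually (gt_mem_nhds hneg)).and self_mem_nhdsWithin).exists
    refine ⟨s, h3, ?_⟩
    have h3 : (0 : ℝ) < s := h3
    rw [zero_add, hg0, smul_eq_mul] at h2
    have := mul_neg_of_pos_of_neg h3 h2
    rw [mul_inv_cancel_left₀ h3.ne'] at this
    linarith
  have hgp : 0 < g s := by
    obtain ⟨i, -, hi⟩ := Finset.exists_ne_zero_of_sum_ne_zero (by rw [hp1]; exact one_ne_zero)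
    exact Finset.sum_pos' (fun j _ => mul_nonneg (hp j) (Real.exp_pos _).le)
      ⟨i, Finset.mem_univ i, mul_pos (lt_of_le_of_ne (hp i) (Ne.symm hi)) (Real.exp_pos _)⟩
  refine ⟨-Real.log (g s), by simpa using Real.log_neg hgp hgs, fun n => ?_⟩
  have hpow : Real.exp (-(n * -Real.log (g s))) = ∏ _k : Fin n, g s := by
    rw [mul_neg, neg_neg, Real.exp_nat_mul, Real.exp_log hgp]; simp
  rw [hpow, hg, prod_sum_fin_real]
  refine Finset.sum_le_sum fun f _ => ?_
  -- Markov's inequality termwise: the tail indicator is at most `exp (s ∑ (x - c))`.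
  rw [Finset.prod_mul_distrib, mul_comm, ← Real.exp_sum]
  refine mul_le_mul_of_nonneg_left ?_ (Finset.prod_nonneg fun k _ => hp _)
  split_ifs with h
  · rw [← Finset.mul_sum, Finset.sum_sub_distrib]
    refine Real.one_le_exp (mul_nonneg hs.le ?_)
    simp only [Finset.sum_const, Finset.card_univ, Fintype.card_fin, nsmul_eq_mul]
    linarith
  · exact (Real.exp_pos _).le

/-- Weak law of large numbers with exponential rate. -/
lemma exists_large_deviation {p : ι → ℝ} (hp : ∀ i, 0 ≤ p i) (hp1 : ∑ i, p i = 1) (x : ι → ℝ)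
    {δ : ℝ} (hδ : 0 < δ) : ∃ η : ℝ, 0 < η ∧ ∀ n : ℕ, 1 - 2 * Real.exp (-(n * η)) ≤
      ∑ f : Fin n → ι, (if n * (∑ i, p i * x i - δ) ≤ ∑ k, x (f k) ∧
        ∑ k, x (f k) ≤ n * (∑ i, p i * x i + δ) then (1 : ℝ) else 0) * ∏ k, p (f k) := by
  set μ := ∑ i, p i * x i with hμ
  obtain ⟨η₁, h1, H1⟩ := exists_chernoff hp hp1 x (c := μ + δ) (by linarith)
  obtain ⟨η₂, h2, H2⟩ := exists_chernoff hp hp1 (fun i => - x i) (c := -μ + δ)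
    (by simp only [mul_neg, Finset.sum_neg_distrib]; linarith)
  refine ⟨min η₁ η₂, lt_min h1 h2, fun n => ?_⟩
  have e1 : Real.exp (-(n * η₁)) ≤ Real.exp (-(n * min η₁ η₂)) := by
    gcongr; exact min_le_left _ _
  have e2 : Real.exp (-(n * η₂)) ≤ Real.exp (-(n * min η₁ η₂)) := by
    gcongr; exact min_le_right _ _
  have hone : ∑ f : Fin n → ι, ∏ k, p (f k) = 1 := by
    rw [← prod_sum_fin_real fun _ => p]; simp [hp1]
  have H := add_le_add (H1 n) (H2 n)
  rw [← Finset.sum_add_distrib] at H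
  -- Every sequence lies in the window or in one of the two tails.
  have : ∑ f : Fin n → ι, ∏ k, p (f k) ≤ ∑ f : Fin n → ι,
      ((if n * (μ - δ) ≤ ∑ k, x (f k) ∧ ∑ k, x (f k) ≤ n * (μ + δ) then (1 : ℝ) else 0) *
        ∏ k, p (f k) + ((if n * (μ + δ) < ∑ k, x (f k) then (1 : ℝ) else 0) * ∏ k, p (f k) +
        (if n * (-μ + δ) < ∑ k, - x (f k) then (1 : ℝ) else 0) * ∏ k, p (f k))) := by
    refine Finset.sum_le_sum fun f _ => ?_
    rw [← add_mul, ← add_mul]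
    refine le_mul_of_one_le_left (Finset.prod_nonneg fun k _ => hp _) ?_
    rw [Finset.sum_neg_distrib]
    split_ifs with c1 c2 c3 c3 c2 c3 c3 <;> norm_num
    exact c1 ⟨by nlinarith, by nlinarith⟩
  rw [hone, Finset.sum_add_distrib] at this
  linarith

end LargeDeviations

/-! ### Spectral projectors are typical. -/

section Spectral

variable {ι : Type*} [Fintype ι] [DecidableEq ι]

lemma cfc_conj_diagonal {U : Matrix ι ι ℂ} (h1 : Uᴴ * U = 1) (h2 : U * Uᴴ = 1) (d : ι → ℝ)
    (f : ℝ → ℝ) : cfc f (U * Matrix.diagonal (fun i => (d i : ℂ)) * Uᴴ) =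
      U * Matrix.diagonal (fun i => (f (d i) : ℂ)) * Uᴴ := by
  set A := U * Matrix.diagonal (fun i => (d i : ℂ)) * Uᴴ with hA
  have hAh : IsSelfAdjoint A := by
    rw [IsSelfAdjoint, Matrix.star_eq_conjTranspose, hA, Matrix.conjTranspose_mul,
      Matrix.conjTranspose_mul, Matrix.conjTranspose_conjTranspose, Matrix.diagonal_conjTranspose,
      Matrix.mul_assoc]
    congr 3
    ext i; simp
  let φ : (ι → ℝ) →ₐ[ℝ] Matrix ι ι ℂ := AlgHom.ofLinearMap
    { toFun := fun d => U * Matrix.diagonal (fun i => (d i : ℂ)) * Uᴴ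
      map_add' := fun a b => by
        rw [← Matrix.add_mul, ← Matrix.mul_add, Matrix.diagonal_add]; simp
      map_smul' := fun c a => by
        rw [RingHom.id_apply, ← Matrix.smul_mul, ← Matrix.mul_smul, ← Matrix.diagonal_smul]
        congr 3; ext i; simp }
    (by simpa using h2)
    (fun a b => by
      simp only [LinearMap.coe_mk, AddHom.coe_mk, Pi.mul_apply, Complex.ofReal_mul]
      rw [← Matrix.diagonal_mul_diagonal]
      calc _ = U * Matrix.diagonal (fun i => (a i : ℂ)) * (Uᴴ * U) *
            Matrix.diagonal (fun i => (b i : ℂ)) * Uᴴ := by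
            rw [h1, Matrix.mul_one]; simp only [Matrix.mul_assoc]
        _ = _ := by simp only [Matrix.mul_assoc])
  -- The nodes contain both the spectrum of `A` and the values of `d`, so one polynomial represents
  -- `f` on both sides without identifying the two sets.
  let s : Finset ℝ := Matrix.finite_real_spectrum (A := A).toFinset ∪ Finset.univ.image d
  let q := Lagrange.interpolate s id f
  have hq : ∀ x ∈ s, q.eval x = f x := fun x hx =>
    Lagrange.eval_interpolate_at_node f Function.injective_id.injOn hx
  have e1 : cfc f A = cfc q.eval A := cfc_congr fun x hx => (hq x (by simp [s, hx])).symm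
  have e2 : Polynomial.aeval (φ d) q = φ (Polynomial.aeval d q) :=
    Polynomial.aeval_algHom_apply φ d q
  have e3 : Polynomial.aeval d q = fun i => f (d i) := by
    ext i
    have := Polynomial.aeval_algHom_apply (Pi.evalAlgHom ℝ (fun _ : ι => ℝ) i) d q
    simp only [Pi.evalAlgHom_apply] at this
    rw [← this, Polynomial.coe_aeval_eq_eval]
    exact hq _ (by simp [s])
  rw [e1, cfc_polynomial q A hAh]
  exact e2.trans (by rw [e3]; rfl)

lemma exists_diagonalization {A : Matrix ι ι ℂ} (hA : A.PosSemidef) :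
    ∃ (U : Matrix ι ι ℂ) (t : ι → ℝ), Uᴴ * U = 1 ∧ U * Uᴴ = 1 ∧ (∀ i, 0 ≤ t i) ∧
      A = U * Matrix.diagonal (fun i => (t i : ℂ)) * Uᴴ :=
  ⟨hA.1.eigenvectorUnitary, hA.1.eigenvalues,
    Matrix.mem_unitaryGroup_iff'.1 hA.1.eigenvectorUnitary.2,
    Matrix.mem_unitaryGroup_iff.1 hA.1.eigenvectorUnitary.2, hA.eigenvalues_nonneg,
    hA.1.spectral_theorem⟩

lemma trace_conj_diagonal_mul (U M : Matrix ι ι ℂ) (d : ι → ℂ) :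
    (U * Matrix.diagonal d * Uᴴ * M).trace = ∑ i, d i * (Uᴴ * M * U) i i := by
  rw [Matrix.mul_assoc, Matrix.mul_assoc, Matrix.trace_mul_comm, Matrix.mul_assoc, Matrix.trace]
  simp only [Matrix.diag, Matrix.diagonal_mul]

/-- The standard relative typical projectors are relative typical projectors. -/
theorem isRelTypical_relTypProj {ρ τ : Matrix ι ι ℂ} (hρ : ρ.PosSemidef) (hρ1 : ρ.trace = 1)
    (hτ : τ.PosSemidef) (hs : SuppLE ρ τ) {δ : ℝ} (hδ : 0 < δ) :
    IsRelTypical ρ τ δ (relTypProj ρ τ δ) := by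
  constructor
  · intro n
    have hT := tensorPow_posSemidef hτ n
    have hid := cfc_matrix_id hT.1
    set T := tensorPow τ n
    set a := Real.exp (-(n * (crossEntropy ρ τ + δ))) with ha
    set b := Real.exp (-(n * (crossEntropy ρ τ - δ))) with hb
    set χ : ℝ → ℝ := Set.indicator (Set.Icc a b) (fun _ => (1 : ℝ)) with hχ
    have hP : relTypProj ρ τ δ n = cfc χ T := rfl
    have hχT : cfc χ T * T = cfc (fun x => χ x * x) T := by
      have := cfc_matrix_mul T χ fun x => x
      rwa [hid] at this
    have hTχ : T * cfc χ T = cfc (fun x => x * χ x) T := by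
      have := cfc_matrix_mul T (fun x => x) χ
      rwa [hid] at this
    have hmid : cfc χ T * T * cfc χ T = cfc (fun x => χ x * x * χ x) T := by
      rw [hχT, cfc_matrix_mul]
    have hsm : ∀ c : ℝ, c • cfc χ T = cfc (fun x => c * χ x) T := fun c =>
      (cfc_const_mul c χ T (Matrix.finite_real_spectrum.continuousOn χ)).symm
    rw [hP]
    refine ⟨⟨?_, cfc_predicate χ T⟩, ?_, ?_, ?_⟩
    · rw [IsIdempotentElem, cfc_matrix_mul]
      congr 1; ext x
      by_cases h : x ∈ Set.Icc a b <;> simp [hχ, h]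
    · rw [Commute, SemiconjBy]
      rw [hχT, hTχ]
      simp only [mul_comm]
    · rw [hmid, hsm]
      refine cfc_mono (fun x _ => ?_) (Matrix.finite_real_spectrum.continuousOn _)
        (Matrix.finite_real_spectrum.continuousOn _)
      by_cases h : x ∈ Set.Icc a b
      · simpa [hχ, h] using h.1
      · simp [hχ, h]
    · rw [hmid, hsm]
      refine cfc_mono (fun x _ => ?_) (Matrix.finite_real_spectrum.continuousOn _)
        (Matrix.finite_real_spectrum.continuousOn _)
      by_cases h : x ∈ Set.Icc a b
      · simpa [hχ, h] using h.2
      · simp [hχ, h]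
  · obtain ⟨U, t, hU1, hU2, ht, hτU⟩ := exists_diagonalization hτ
    have hpp : (Uᴴ * ρ * U).PosSemidef := hρ.conjTranspose_mul_mul_same U
    -- The outcome distribution of measuring `ρ` in the eigenbasis of `τ`.
    set p : ι → ℝ := fun i => ((Uᴴ * ρ * U) i i).re with hp
    have hpc : ∀ i, (Uᴴ * ρ * U) i i = (p i : ℂ) := fun i =>
      Complex.ext rfl (by simpa using ((Complex.le_def.1 (hpp.diag_nonneg (i := i))).2).symm)
    have hp0 : ∀ i, 0 ≤ p i := fun i => (Complex.le_def.1 (hpp.diag_nonneg (i := i))).1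
    have hp1 : ∑ i, p i = 1 := by
      have : (Uᴴ * ρ * U).trace = 1 := by
        rw [Matrix.mul_assoc, Matrix.trace_mul_comm, Matrix.mul_assoc, hU2, Matrix.mul_one, hρ1]
      rw [Matrix.trace] at this
      simp only [Matrix.diag, hpc] at this
      exact_mod_cast this
    -- The support condition makes the convention `Real.log 0 = 0` harmless: zero eigenvalues carry
    -- no probability.
    have hpt : ∀ i, t i = 0 → p i = 0 := fun i hi => by
      have h1 : τ * U = U * Matrix.diagonal (fun i => (t i : ℂ)) := by
        rw [hτU, Matrix.mul_assoc, hU1, Matrix.mul_one]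
      have h2 : τ.mulVec (fun j => U j i) = 0 := by
        ext j
        have := congrFun (congrFun h1 j) i
        rw [Matrix.mul_diagonal, hi] at this
        rw [Complex.ofReal_zero, mul_zero] at this
        exact this
      have h3 := hs _ h2
      have h4 : ∀ j, (ρ * U) j i = 0 := fun j => congrFun h3 j
      simp only [hp, Matrix.mul_assoc]
      rw [Matrix.mul_apply]
      simp [h4]
    have hcross : crossEntropy ρ τ = ∑ i, p i * (- Real.log (t i)) := by
      rw [crossEntropy, opLog, hτU, cfc_conj_diagonal hU1 hU2, Matrix.trace_mul_comm,
        trace_conj_diagonal_mul, Complex.re_sum, ← Finset.sum_neg_distrib]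
      refine Finset.sum_congr rfl fun i _ => ?_
      rw [hpc, Complex.re_ofReal_mul, Complex.ofReal_re]; ring
    obtain ⟨η, hη, H⟩ := exists_large_deviation hp0 hp1 (fun i => - Real.log (t i)) hδ
    refine ⟨η, hη, fun n => (H n).trans ?_⟩
    rw [← hcross]
    have hT : tensorPow τ n = tensorPow U n *
        Matrix.diagonal (fun f => ((∏ k, t (f k) : ℝ) : ℂ)) * (tensorPow U n)ᴴ := by
      rw [hτU, tensorPow_mul, tensorPow_mul, tensorPow_diagonal, tensorPow_conjTranspose]
      simp
    have hV1 : (tensorPow U n)ᴴ * tensorPow U n = 1 := by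
      rw [← tensorPow_conjTranspose, ← tensorPow_mul, hU1, tensorPow_one]
    have hV2 : tensorPow U n * (tensorPow U n)ᴴ = 1 := by
      rw [← tensorPow_conjTranspose, ← tensorPow_mul, hU2, tensorPow_one]
    rw [relTypProj, hT, cfc_conj_diagonal hV1 hV2, trace_conj_diagonal_mul, Complex.re_sum]
    refine Finset.sum_le_sum fun f _ => ?_
    rw [← tensorPow_conjTranspose, ← tensorPow_mul, ← tensorPow_mul]
    have : tensorPow (Uᴴ * ρ * U) n f f = ((∏ k, p (f k) : ℝ) : ℂ) := by
      simp [tensorPow, hpc]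
    rw [this, Complex.re_ofReal_mul, Complex.ofReal_re]
    -- A sequence meeting a zero eigenvalue may be counted in the window of logarithms but has
    -- weight zero.
    by_cases hz : ∃ k, t (f k) = 0
    · obtain ⟨k, hk⟩ := hz
      rw [Finset.prod_eq_zero (Finset.mem_univ k) (hpt _ hk)]; simp
    · push Not at hz
      have hpos : ∀ k, 0 < t (f k) := fun k => lt_of_le_of_ne (ht _) (hz k).symm
      refine mul_le_mul_of_nonneg_right ?_ (Finset.prod_nonneg fun k _ => hp0 _)
      have hprod : ∏ k, t (f k) = Real.exp (-∑ k, -Real.log (t (f k))) := by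
        rw [Finset.sum_neg_distrib, neg_neg, Real.exp_sum]
        exact Finset.prod_congr rfl fun k _ => (Real.exp_log (hpos k)).symm
      split_ifs with h
      · rw [Set.indicator_of_mem]
        rw [hprod]
        exact ⟨Real.exp_le_exp.2 (by linarith [h.2]), Real.exp_le_exp.2 (by linarith [h.1])⟩
      · exact Set.indicator_nonneg (fun _ _ => zero_le_one) _

end Spectral

/-! ### Operator inequalities for projections. -/

section Projections

variable {m : Type*} [Fintype m] [DecidableEq m]

/-- The difference is `(1 - P) G (1 - P)`. -/
lemma mul_mul_self_le_of_commute {P G : Matrix m m ℂ} (hP : IsStarProjection P)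
    (hG : G.PosSemidef) (h : Commute P G) : P * G * P ≤ G := by
  have h1 : (1 - P)ᴴ = 1 - P := hP.one_sub.isSelfAdjoint.star_eq
  have h2 : P * P = P := hP.isIdempotentElem.eq
  have h3 : P * G * P = P * G := by rw [Matrix.mul_assoc, ← h.eq, ← Matrix.mul_assoc, h2]
  have h4 := hG.conjTranspose_mul_mul_same (1 - P)
  rw [Matrix.le_iff, h3]
  have : (1 - P)ᴴ * G * (1 - P) = G - P * G := by
    rw [h1, Matrix.mul_sub, Matrix.sub_mul, Matrix.sub_mul, Matrix.mul_one, Matrix.mul_one,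
      Matrix.one_mul, Matrix.sub_mul, h3, ← h.eq, sub_self, sub_zero]
  rwa [this] at h4

lemma proj_conj_mono {A B P : Matrix m m ℂ} (hP : IsStarProjection P) (h : A ≤ B) :
    P * A * P ≤ P * B * P := by
  have h1 : Pᴴ = P := hP.isSelfAdjoint.star_eq
  simpa only [h1] using conj_mono h P

/-- Discards an inner projection that need not commute with the outer one. -/
lemma proj_conj_proj_le {P R : Matrix m m ℂ} (hP : IsStarProjection P) (hR : IsStarProjection R) :
    P * R * P ≤ P := by
  have h2 : P * P = P := hP.isIdempotentElem.eq
  simpa [h2] using proj_conj_mono hP hR.le_one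

lemma le_inv_smul {A B : Matrix m m ℂ} {a : ℝ} (ha : 0 < a) (h : a • A ≤ B) : A ≤ a⁻¹ • B := by
  have := smul_le_smul_of_nonneg_left h (inv_pos.2 ha).le
  rwa [smul_smul, inv_mul_cancel₀ ha.ne', one_smul] at this

/-- On a spectral subspace where a generalized inverse of `G` is at most `b`, `G ≥ b⁻¹`. -/
lemma proj_le_smul_of_inv {G τ S : Matrix m m ℂ} (hG : G.PosSemidef) (hτ : τ.IsHermitian)
    (hGτ : G * τ = τ * G) (hτGτ : τ * G * τ = τ) (hS : IsStarProjection S)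
    (hSτ : Commute S τ) {a b : ℝ} (ha : 0 < a) (hb : 0 ≤ b)
    (h1 : a • S ≤ S * τ * S) (h2 : S * τ * S ≤ b • S) : S ≤ b • G := by
  have hSh : Sᴴ = S := hS.isSelfAdjoint.star_eq
  have hSS : S * S = S := hS.isIdempotentElem.eq
  have hSτS : S * τ * S = τ * S := by rw [hSτ.eq, Matrix.mul_assoc, hSS]
  -- The projection onto the kernel of `τ`. The strictly positive lower bound `h1` forces `S N = 0`,
  -- so `τ G` acts as the identity on the range of `S`.
  set N := 1 - τ * G with hN
  have hNh : Nᴴ = N := by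
    rw [hN, Matrix.conjTranspose_sub, Matrix.conjTranspose_one, Matrix.conjTranspose_mul, hG.1.eq,
      hτ.eq, hGτ]
  have hNτ : N * τ = 0 := by rw [hN, Matrix.sub_mul, Matrix.one_mul, hτGτ, sub_self]
  have hSN : S * N = 0 := by
    have h3 := conj_mono' h1 N
    rw [hSτS, hNh, ← Matrix.mul_assoc, hNτ, Matrix.zero_mul, Matrix.zero_mul, Matrix.mul_smul,
      Matrix.smul_mul] at h3
    have h4 := le_inv_smul ha h3
    rw [smul_zero] at h4
    have h5 : N * S * N = (S * N)ᴴ * (S * N) := by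
      rw [Matrix.conjTranspose_mul, hSh, hNh]
      simp only [← Matrix.mul_assoc]
      rw [Matrix.mul_assoc N S S, hSS]
    rw [h5] at h4
    have h6 := le_antisymm h4
      (Matrix.nonneg_iff_posSemidef.2 (Matrix.posSemidef_conjTranspose_mul_self (S * N)))
    exact Matrix.conjTranspose_mul_self_eq_zero.1 h6
  have hSPi : S * (τ * G) = S := by
    rw [hN, Matrix.mul_sub, Matrix.mul_one, sub_eq_zero] at hSN
    exact hSN.symm
  have hPiS : τ * G * S = S := by
    have := congrArg Matrix.conjTranspose hSPi
    rwa [Matrix.conjTranspose_mul, Matrix.conjTranspose_mul, hSh, hτ.eq, hG.1.eq, hGτ] at this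
  have hSG : Commute S G := by
    rw [Commute, SemiconjBy]
    symm
    calc G * S = G * (S * (τ * G)) := by rw [hSPi]
      _ = G * (S * τ) * G := by simp only [Matrix.mul_assoc]
      _ = G * τ * S * G := by rw [hSτ.eq]; simp only [Matrix.mul_assoc]
      _ = S * G := by rw [hGτ, hPiS]
  set H := opSqrt G with hH
  have hHH : H * H = G := opSqrt_mul_self hG
  have hHh : Hᴴ = H := opSqrt_isHermitian G
  have hHS : Commute H S := hSG.symm.cfc_real Real.sqrt
  have hHτ : Commute H τ := (show Commute G τ from hGτ).cfc_real Real.sqrt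
  -- Conjugation by `√G` cancels `τ` and turns `S τ S ≤ b S` into `S ≤ b S G S`.
  have h3 := conj_mono h2 H
  have e1 : H * (S * τ * S) * Hᴴ = S := by
    calc H * (S * τ * S) * Hᴴ = H * τ * (S * H) := by
          rw [hSτS, hHh]; simp only [Matrix.mul_assoc]
      _ = τ * (H * H) * S := by rw [hHτ.eq, ← hHS.eq]; simp only [Matrix.mul_assoc]
      _ = S := by rw [hHH, hPiS]
  have e2 : H * (b • S) * Hᴴ = b • (S * G * S) := by
    rw [hHh, Matrix.mul_smul, Matrix.smul_mul, hHS.eq, Matrix.mul_assoc, hHH,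
      Matrix.mul_assoc S G, ← hSG.eq, ← Matrix.mul_assoc S S, hSS]
  rw [e1, e2] at h3
  exact h3.trans (smul_le_smul_of_nonneg_left (mul_mul_self_le_of_commute hS hG hSG) hb)

end Projections

/-! ### One-shot estimates: Γ-bound, distance and converse. -/

section Channels

variable {a b r e : Type*} [Fintype a] [Fintype b] [Fintype r] [Fintype e]
  [DecidableEq a] [DecidableEq b] [DecidableEq r] [DecidableEq e]

lemma isContr_ampl_mul {S Q : Matrix b b ℂ} (hS : IsStarProjection S) (hQ : IsStarProjection Q) :
    IsContr (ampl e (S * Q)) := by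
  rw [ampl_mul]
  exact (isContr_of_isStarProjection (ampl_isStarProjection hS)).mul
    (isContr_of_isStarProjection (ampl_isStarProjection hQ))

lemma IsStinespring.hsNorm_mul_eq {F : Matrix a a ℂ →ₗ[ℂ] Matrix b b ℂ} {V : Matrix (b × e) a ℂ}
    (h : IsStinespring F V) (hF : IsTracePreserving F) (C : Matrix a r ℂ) :
    hsNorm (V * C) = hsNorm C := by
  rw [← sq_eq_sq₀ (hsNorm_nonneg _) (hsNorm_nonneg _), h.hsNorm_sq, hF, hsNorm_sq']

lemma IsStinespring.hsNorm_mul_le {F : Matrix a a ℂ →ₗ[ℂ] Matrix b b ℂ} {V : Matrix (b × e) a ℂ}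
    (h : IsStinespring F V) (hF : IsTraceNonincreasing F) (C : Matrix a r ℂ) :
    hsNorm (V * C) ≤ hsNorm C := by
  rw [← sq_le_sq₀ (hsNorm_nonneg _) (hsNorm_nonneg _), h.hsNorm_sq, hsNorm_sq']
  exact hF _ (Matrix.posSemidef_self_mul_conjTranspose C)

lemma sandwich_isTraceNonincreasing {F : Matrix a a ℂ →ₗ[ℂ] Matrix b b ℂ}
    {V : Matrix (b × e) a ℂ} (h : IsStinespring F V) (hF : IsTracePreserving F)
    {S Q : Matrix b b ℂ} {P R : Matrix a a ℂ} (hS : IsStarProjection S) (hQ : IsStarProjection Q)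
    (hP : IsStarProjection P) (hR : IsStarProjection R) :
    IsTraceNonincreasing (sandwich F S Q P R) := fun A hA => by
  have hst := h.sandwich (S := S) (Q := Q) (P := P) (R := R) hS.isSelfAdjoint.star_eq
    hQ.isSelfAdjoint.star_eq hP.isSelfAdjoint.star_eq hR.isSelfAdjoint.star_eq
  have hA' : opSqrt A * (opSqrt A)ᴴ = A := by rw [opSqrt_isHermitian, opSqrt_mul_self hA]
  have h1 := hst.hsNorm_sq (opSqrt A)
  have h2 := hsNorm_sq' (opSqrt A)
  rw [hA'] at h1 h2
  rw [← h1, ← h2]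
  refine pow_le_pow_left₀ (hsNorm_nonneg _) ?_ 2
  simp only [Matrix.mul_assoc]
  calc _ ≤ hsNorm (V * (R * (P * opSqrt A))) := (isContr_ampl_mul hS hQ).hsNorm_mul_le _
    _ = hsNorm (R * (P * opSqrt A)) := h.hsNorm_mul_eq hF _
    _ ≤ hsNorm (P * opSqrt A) := (isContr_of_isStarProjection hR).hsNorm_mul_le _
    _ ≤ _ := (isContr_of_isStarProjection hP).hsNorm_mul_le _

/-- The state `s` is the bridge through the channel: the truncated input is dominated by `s`, and
only `F s` must be controlled at the output. -/
lemma sandwich_le {F : Matrix a a ℂ →ₗ[ℂ] Matrix b b ℂ}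
    {V : Matrix (b × e) a ℂ} (h : IsStinespring F V)
    {S Q : Matrix b b ℂ} {P R : Matrix a a ℂ} (hS : IsStarProjection S) (hQ : IsStarProjection Q)
    (hP : IsStarProjection P) (hR : IsStarProjection R) {G s : Matrix a a ℂ} {G' : Matrix b b ℂ}
    {b₁ b₂ b₃ b₄ : ℝ} (h1 : 0 ≤ b₁) (h2 : 0 ≤ b₂) (h3 : 0 ≤ b₃)
    (H1 : P * G * P ≤ b₁ • P) (H2 : R ≤ b₂ • s) (H3 : Q * F s * Q ≤ b₃ • Q) (H4 : S ≤ b₄ • G') :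
    sandwich F S Q P R G ≤ (b₁ * b₂ * b₃ * b₄) • G' := by
  have e1 : R * P * G * P * R ≤ (b₁ * b₂) • s := by
    calc R * P * G * P * R = R * (P * G * P) * R := by simp only [Matrix.mul_assoc]
      _ ≤ R * (b₁ • P) * R := proj_conj_mono hR H1
      _ = b₁ • (R * P * R) := by rw [Matrix.mul_smul, Matrix.smul_mul]
      _ ≤ b₁ • (b₂ • s) := smul_le_smul_of_nonneg_left ((proj_conj_proj_le hR hP).trans H2) h1
      _ = _ := smul_smul _ _ _
  have e2 : F (R * P * G * P * R) ≤ (b₁ * b₂) • F s := by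
    have := h.mono e1
    rwa [LinearMap.map_smul_of_tower] at this
  calc sandwich F S Q P R G = S * (Q * F (R * P * G * P * R) * Q) * S := by
        simp [sandwich, Matrix.mul_assoc]
    _ ≤ S * (Q * ((b₁ * b₂) • F s) * Q) * S := proj_conj_mono hS (proj_conj_mono hQ e2)
    _ = (b₁ * b₂) • (S * (Q * F s * Q) * S) := by
        simp only [Matrix.mul_smul, Matrix.smul_mul]
    _ ≤ (b₁ * b₂) • (S * (b₃ • Q) * S) :=
        smul_le_smul_of_nonneg_left (proj_conj_mono hS H3) (mul_nonneg h1 h2)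
    _ = (b₁ * b₂ * b₃) • (S * Q * S) := by
        rw [Matrix.mul_smul, Matrix.smul_mul, smul_smul]
    _ ≤ (b₁ * b₂ * b₃) • (b₄ • G') :=
        smul_le_smul_of_nonneg_left ((proj_conj_proj_le hS hQ).trans H4)
          (mul_nonneg (mul_nonneg h1 h2) h3)
    _ = _ := smul_smul _ _ _

/-- `1 - F² ≤ 2 (1 - F)` for every real `F`, and the second summand of the generalized fidelity only
helps. -/
lemma purifiedDist_le_sqrt {ρ τ : Matrix b b ℂ} {x : ℝ}
    (h : 1 - x ≤ traceNorm (opSqrt ρ * opSqrt τ)) : purifiedDist ρ τ ≤ √(2 * x) := by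
  refine Real.sqrt_le_sqrt ?_
  have h1 : 1 - x ≤ genFidelity ρ τ := h.trans (le_add_of_nonneg_right (Real.sqrt_nonneg _))
  nlinarith [sq_nonneg (genFidelity ρ τ - 1)]

lemma hsNorm_ketMatrix {ψ : a × r → ℂ} (hψ : IsUnitKet ψ) : hsNorm (ketMatrix ψ) = 1 := by
  have : hsNorm (ketMatrix ψ) ^ 2 = 1 := by
    rw [hsNorm_sq', ← ptraceRight_ketBra, trace_ptraceRight, trace_ketBra hψ, Complex.one_re]
  nlinarith [hsNorm_nonneg (ketMatrix ψ)]

/-- The smoothed map reproduces the process matrix up to the weights lost by the projections. -/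
lemma purifiedDist_sandwich_le {F : Matrix a a ℂ →ₗ[ℂ] Matrix b b ℂ}
    {V : Matrix (b × e) a ℂ} (h : IsStinespring F V) (hF : IsTracePreserving F)
    {S Q : Matrix b b ℂ} {P R : Matrix a a ℂ} (hS : IsStarProjection S) (hQ : IsStarProjection Q)
    (hP : IsStarProjection P) (hR : IsStarProjection R) {ψ : a × r → ℂ} (hψ : IsUnitKet ψ)
    {s : Matrix a a ℂ} (hs : s = ptraceRight (ketBra ψ)) :
    purifiedDist (applyLeft (sandwich F S Q P R) (ketBra ψ)) (applyLeft F (ketBra ψ)) ≤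
      √(2 * ((√(1 - (S * F s).trace.re) + √(1 - (Q * F s).trace.re)) +
        (√(1 - (R * s).trace.re) + √(1 - (P * s).trace.re)))) := by
  refine purifiedDist_le_sqrt ?_
  have hst := h.sandwich (S := S) (Q := Q) (P := P) (R := R) hS.isSelfAdjoint.star_eq
    hQ.isSelfAdjoint.star_eq hP.isSelfAdjoint.star_eq hR.isSelfAdjoint.star_eq
  rw [hst.applyLeft_ketBra, h.applyLeft_ketBra]
  refine le_trans ?_ (re_trace_le_traceNorm_sqrt_mul_sqrt _ _)
  rw [trace_reshuffle]
  have hB := hsNorm_ketMatrix hψ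
  have hBs : ketMatrix ψ * (ketMatrix ψ)ᴴ = s := by rw [hs, ptraceRight_ketBra]
  set B := ketMatrix ψ
  set K := ampl e (S * Q)
  have hVB : hsNorm (V * B) = 1 := by rw [h.hsNorm_mul_eq hF, hB]
  set D := V * B - K * V * (R * P) * B with hD
  have hVBs : V * B * (V * B)ᴴ = V * s * Vᴴ := by
    rw [← hBs, Matrix.conjTranspose_mul]; simp only [Matrix.mul_assoc]
  have hw : ∀ X : Matrix b b ℂ, (ampl e X * (V * B * (V * B)ᴴ)).trace = (X * F s).trace :=
    fun X => by rw [hVBs, ← trace_ptraceRight, ptraceRight_ampl_mul, ← h]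
  have h1 : hsNorm D ≤ (√(1 - (S * F s).trace.re) + √(1 - (Q * F s).trace.re)) +
        (√(1 - (R * s).trace.re) + √(1 - (P * s).trace.re)) := by
    -- Separates the loss from the output projections from that of the input projections, which is
    -- carried through the isometry `V`.
    have : D = (V * B - K * (V * B)) + K * (V * (B - R * P * B)) := by
      simp only [hD, Matrix.mul_sub, Matrix.mul_assoc]; abel
    rw [this]
    refine (hsNorm_add_le _ _).trans (add_le_add ?_ ?_)
    · have := hsNorm_sub_mul_mul_le (ampl_isStarProjection (r := e) hS)
        (ampl_isStarProjection (r := e) hQ) (B := V * B) (by rw [← hsNorm_sq', hVB]; norm_num)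
      rwa [hw, hw, ← ampl_mul] at this
    · refine ((isContr_ampl_mul hS hQ).hsNorm_mul_le _).trans ?_
      rw [h.hsNorm_mul_eq hF]
      have := hsNorm_sub_mul_mul_le hR hP (B := B) (by rw [← hsNorm_sq', hB]; norm_num)
      rwa [hBs] at this
  have h2 := re_trace_conjTranspose_mul_le D (V * B)
  rw [hVB, mul_one] at h2
  have h3 : (Dᴴ * (V * B)).trace.re =
      1 - ((K * V * (R * P) * B)ᴴ * (V * B)).trace.re := by
    rw [hD, Matrix.conjTranspose_sub, Matrix.sub_mul, Matrix.trace_sub, Complex.sub_re,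
      ← hsNorm_sq, hVB, one_pow]
  linarith

/-- Converse bound: a map that reproduces the process matrix cannot shrink `Γ` too much. -/
lemma sqrt_le_of_purifiedDist_le {T : Matrix a a ℂ →ₗ[ℂ] Matrix b b ℂ}
    {V : Matrix (b × e) a ℂ} (h : IsStinespring T V) (hT : IsTraceNonincreasing T)
    {S Q : Matrix b b ℂ} {P R : Matrix a a ℂ} (hS : IsStarProjection S) (hQ : IsStarProjection Q)
    (hP : IsStarProjection P) (hR : IsStarProjection R) {ψ : a × r → ℂ} (hψ : IsUnitKet ψ)
    {s : Matrix a a ℂ} (hs : s = ptraceRight (ketBra ψ))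
    {ω : Matrix (b × r) (b × r) ℂ} (hω : ω.PosSemidef) (hω1 : ω.trace = 1)
    {t : Matrix b b ℂ} (ht : t = ptraceRight ω) {ε : ℝ}
    (hε : purifiedDist (applyLeft T (ketBra ψ)) ω ≤ ε)
    {G : Matrix a a ℂ} {G' : Matrix b b ℂ} {α b₁ b₂ b₃ b₄ : ℝ} (hα : 0 ≤ α) (h1 : 0 ≤ b₁)
    (h3 : 0 ≤ b₃) (h4 : 0 ≤ b₄) (hTG : T G ≤ α • G')
    (H1 : S * G' * S ≤ b₁ • S) (H2 : Q.trace.re ≤ b₂) (H3 : R * s * R ≤ b₃ • R)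
    (H4 : P ≤ b₄ • G) :
    √(1 - ε ^ 2) ≤ √(b₃ * b₄ * α * b₁ * b₂) +
      ((√(1 - (P * s).trace.re) + √(1 - (R * s).trace.re)) +
      (√(1 - (S * t).trace.re) + √(1 - (Q * t).trace.re))) := by
  have hSh : Sᴴ = S := hS.isSelfAdjoint.star_eq
  have hQh : Qᴴ = Q := hQ.isSelfAdjoint.star_eq
  have hPh : Pᴴ = P := hP.isSelfAdjoint.star_eq
  have hRh : Rᴴ = R := hR.isSelfAdjoint.star_eq
  have hQQ : Q * Q = Q := hQ.isIdempotentElem.eq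
  have hB := hsNorm_ketMatrix hψ
  have hBs : ketMatrix ψ * (ketMatrix ψ)ᴴ = s := by rw [hs, ptraceRight_ketBra]
  have hap := h.applyLeft_ketBra ψ
  set B := ketMatrix ψ
  set ω' := applyLeft T (ketBra ψ)
  set K := ampl e (Q * S)
  have hK : IsContr K := isContr_ampl_mul hQ hS
  have hres : ∀ M : Matrix (b × e) r ℂ, hsNorm (reshuffle M) = hsNorm M := fun M => by
    rw [← sq_eq_sq₀ (hsNorm_nonneg _) (hsNorm_nonneg _), hsNorm_sq, hsNorm_sq, trace_reshuffle]
  have hω' : ω'.PosSemidef := by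
    rw [hap]; exact Matrix.posSemidef_self_mul_conjTranspose _
  have hω'1 : ω'.trace.re ≤ 1 := by
    rw [hap, ← hsNorm_sq', hres]
    have := h.hsNorm_mul_le hT B
    rw [hB] at this
    exact pow_le_one₀ (hsNorm_nonneg _) this
  -- the fidelity is bounded below
  have hfid : √(1 - ε ^ 2) ≤ traceNorm (opSqrt ω' * opSqrt ω) := by
    have e1 : genFidelity ω' ω = traceNorm (opSqrt ω' * opSqrt ω) := by
      rw [genFidelity, hω1]; simp
    have e2 : 0 ≤ traceNorm (opSqrt ω' * opSqrt ω) :=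
      (Complex.le_def.1 (cfc_matrix_posSemidef (Matrix.posSemidef_conjTranspose_mul_self _)
        fun x _ => Real.sqrt_nonneg x).trace_nonneg).1
    rw [← e1] at e2 ⊢
    refine Real.sqrt_le_iff.2 ⟨e2, ?_⟩
    have := (Real.sqrt_le_iff.1 hε).2
    linarith
  -- The test is `S Q` on the output, identity on the reference.
  have h5 := traceNorm_sqrt_mul_sqrt_le hω' hω hω'1 (by rw [hω1]; simp) (ampl r (S * Q))
  have e3 : ((ampl r (S * Q))ᴴ * ω' * ampl r (S * Q)).trace.re = hsNorm (K * V * B) ^ 2 := by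
    have : (ampl r (S * Q))ᴴ = ampl r (Q * S) := by
      rw [← ampl_conjTranspose, Matrix.conjTranspose_mul, hSh, hQh]
    rw [hap, this, Matrix.mul_assoc K, ← hres, ← ampl_mul_reshuffle, hsNorm_sq',
      Matrix.conjTranspose_mul (ampl r (Q * S)), ← this, Matrix.conjTranspose_conjTranspose]
    simp only [Matrix.mul_assoc]
  rw [e3, Real.sqrt_sq (hsNorm_nonneg _)] at h5
  have h6 : hsNorm (opSqrt ω - ampl r (S * Q) * opSqrt ω) ≤
      √(1 - (S * t).trace.re) + √(1 - (Q * t).trace.re) := by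
    have hww : opSqrt ω * (opSqrt ω)ᴴ = ω := by rw [opSqrt_isHermitian, opSqrt_mul_self hω]
    have := hsNorm_sub_mul_mul_le (ampl_isStarProjection (r := r) hS)
        (ampl_isStarProjection (r := r) hQ) (B := opSqrt ω) (by rw [hww, hω1]; simp)
    have hw : ∀ X : Matrix b b ℂ, (ampl r X * ω).trace = (X * t).trace :=
      fun X => by rw [ht, ← trace_ptraceRight, ptraceRight_ampl_mul]
    rwa [hww, hw, hw, ← ampl_mul] at this
  -- the test passes with small probability
  have h7 : hsNorm (K * V * B) ≤ hsNorm (K * V * (P * R * B)) +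
      (√(1 - (P * s).trace.re) + √(1 - (R * s).trace.re)) := by
    have : K * V * B = K * V * (P * R * B) + K * (V * (B - P * R * B)) := by
      simp only [Matrix.mul_sub, Matrix.mul_assoc]; abel
    rw [this]
    refine (hsNorm_add_le _ _).trans (add_le_add le_rfl ?_)
    refine (hK.hsNorm_mul_le _).trans ((h.hsNorm_mul_le hT _).trans ?_)
    have := hsNorm_sub_mul_mul_le hP hR (B := B) (by rw [← hsNorm_sq', hB]; norm_num)
    rwa [hBs] at this
  have h8 : hsNorm (K * V * (P * R * B)) ≤ √(b₃ * b₄ * α * b₁ * b₂) := by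
    refine Real.le_sqrt_of_sq_le ?_
    have e4 : hsNorm (K * V * (P * R * B)) ^ 2 =
        (Q * (S * T (P * (R * s * R) * P) * S) * Q).trace.re := by
      have e5 : K * V * (P * R * B) * (K * V * (P * R * B))ᴴ =
          K * (V * (P * (R * s * R) * P) * Vᴴ * ampl e (S * Q)) := by
        have : ampl e (S * Q) = Kᴴ := by
          rw [← ampl_conjTranspose, Matrix.conjTranspose_mul, hSh, hQh]
        rw [this, ← hBs]
        simp only [Matrix.conjTranspose_mul, hPh, hRh, Matrix.mul_assoc]
      rw [hsNorm_sq', e5, ← trace_ptraceRight, ptraceRight_ampl_mul, ptraceRight_mul_ampl, ← h]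
      simp only [Matrix.mul_assoc]
    rw [e4]
    -- After truncation the input state is flat enough to be dominated by a multiple of `G`, which
    -- brings `hTG` into play.
    have e6 : P * (R * s * R) * P ≤ (b₃ * b₄) • G := by
      calc P * (R * s * R) * P ≤ P * (b₃ • R) * P := proj_conj_mono hP H3
        _ = b₃ • (P * R * P) := by rw [Matrix.mul_smul, Matrix.smul_mul]
        _ ≤ b₃ • (b₄ • G) := smul_le_smul_of_nonneg_left ((proj_conj_proj_le hP hR).trans H4) h3
        _ = _ := smul_smul _ _ _
    have e7 : T (P * (R * s * R) * P) ≤ (b₃ * b₄ * α) • G' := by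
      refine (h.mono e6).trans ?_
      rw [LinearMap.map_smul_of_tower, mul_smul _ α]
      exact smul_le_smul_of_nonneg_left hTG (mul_nonneg h3 h4)
    have hnn : 0 ≤ b₃ * b₄ * α := mul_nonneg (mul_nonneg h3 h4) hα
    have e8 : Q * (S * T (P * (R * s * R) * P) * S) * Q ≤ (b₃ * b₄ * α * b₁) • Q := by
      calc _ ≤ Q * (S * ((b₃ * b₄ * α) • G') * S) * Q :=
            proj_conj_mono hQ (proj_conj_mono hS e7)
        _ = (b₃ * b₄ * α) • (Q * (S * G' * S) * Q) := by
            simp only [Matrix.mul_smul, Matrix.smul_mul]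
        _ ≤ (b₃ * b₄ * α) • (Q * (b₁ • S) * Q) :=
            smul_le_smul_of_nonneg_left (proj_conj_mono hQ H1) hnn
        _ = (b₃ * b₄ * α * b₁) • (Q * S * Q) := by
            rw [Matrix.mul_smul, Matrix.smul_mul, smul_smul]
        _ ≤ _ := smul_le_smul_of_nonneg_left (proj_conj_proj_le hQ hS) (mul_nonneg hnn h1)
    refine (trace_re_mono e8).trans ?_
    rw [Matrix.trace_smul, Complex.smul_re, smul_eq_mul]
    exact mul_le_mul_of_nonneg_left H2 (mul_nonneg hnn h1)
  linarith

end Channels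

/-! ### Inverse and logarithm on the support. -/

section GeneralizedInverse

variable {ι : Type*} [Fintype ι] [DecidableEq ι]

lemma opInv_posSemidef {A : Matrix ι ι ℂ} (hA : A.PosSemidef) : (opInv A).PosSemidef :=
  cfc_matrix_posSemidef hA fun _ hx => inv_nonneg.2 hx

lemma mul_opInv_comm (A : Matrix ι ι ℂ) : A * opInv A = opInv A * A := by
  have hc : Commute (cfc (fun x : ℝ => x⁻¹) A) A := (Commute.refl A).cfc_real _
  exact hc.eq.symm

lemma mul_opInv_mul {A : Matrix ι ι ℂ} (hA : A.PosSemidef) : A * opInv A * A = A := by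
  have h1 := cfc_matrix_mul A (fun x => x) (fun x => x⁻¹)
  have h2 := cfc_matrix_mul A (fun x => x * x⁻¹) (fun x => x)
  rw [← h1, cfc_matrix_id hA.1] at h2
  have h3 : cfc (fun x : ℝ => x * x⁻¹ * x) A = cfc (fun x : ℝ => x) A := by
    congr 1; ext x
    by_cases h : x = 0 <;> simp [h]
  rw [h3, cfc_matrix_id hA.1] at h2
  exact h2

lemma opInv_mul_mul {A : Matrix ι ι ℂ} (hA : A.PosSemidef) : opInv A * A * opInv A = opInv A := by
  have h1 := cfc_matrix_mul A (fun x => x⁻¹) (fun x => x)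
  have h2 := cfc_matrix_mul A (fun x => x⁻¹ * x) (fun x => x⁻¹)
  rw [← h1, cfc_matrix_id hA.1] at h2
  have h3 : cfc (fun x : ℝ => x⁻¹ * x * x⁻¹) A = cfc (fun x : ℝ => x⁻¹) A := by
    congr 1; ext x
    by_cases h : x = 0 <;> simp [h]
  rw [h3] at h2
  exact h2

/-- `τ` is a left multiple of its generalized inverse, `τ = τ τ τ⁻¹`, so the kernel of `τ⁻¹` lies in
that of `τ`. -/
lemma SuppLE.opInv {ρ τ : Matrix ι ι ℂ} (h : SuppLE ρ τ) (hτ : τ.PosSemidef) :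
    SuppLE ρ (opInv τ) := fun v hv => by
  refine h v ?_
  rw [← mul_opInv_mul hτ, Matrix.mul_assoc, ← mul_opInv_comm τ, ← Matrix.mul_assoc,
    ← Matrix.mulVec_mulVec, hv, Matrix.mulVec_zero]

lemma suppLE_refl (ρ : Matrix ι ι ℂ) : SuppLE ρ ρ := fun _ h => h

/-- `log x⁻¹ = -log x` holds for all real `x`, at `0` by convention. -/
lemma opLog_opInv (τ : Matrix ι ι ℂ) : opLog (opInv τ) = -opLog τ := by
  rw [opLog, opLog, opInv]
  by_cases hτ : IsSelfAdjoint τ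
  · rw [← cfc_comp Real.log (fun x : ℝ => x⁻¹) τ hτ
      ((Matrix.finite_real_spectrum.image _).continuousOn _)
      (Matrix.finite_real_spectrum.continuousOn _), ← cfc_neg]
    congr 1; ext x; simp
  · rw [cfc_apply_of_not_predicate τ hτ, cfc_apply_of_not_predicate τ hτ]
    simp

lemma crossEntropy_opInv (ρ τ : Matrix ι ι ℂ) :
    crossEntropy ρ (opInv τ) = -crossEntropy ρ τ := by
  rw [crossEntropy, crossEntropy, opLog_opInv, Matrix.mul_neg, Matrix.trace_neg, Complex.neg_re]

lemma relEntropy_eq (ρ τ : Matrix ι ι ℂ) :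
    relEntropy ρ τ = crossEntropy ρ τ - crossEntropy ρ ρ := by
  rw [relEntropy, crossEntropy, crossEntropy, Matrix.mul_sub, Matrix.trace_sub, Complex.sub_re]
  ring

end GeneralizedInverse

/-! ### Consequences of relative typicality. -/

section RelTypical

variable {ι : Type*} [Fintype ι] [DecidableEq ι] {ρ τ : Matrix ι ι ℂ} {δ : ℝ}
  {Pr : ∀ n : ℕ, Matrix (Fin n → ι) (Fin n → ι) ℂ}

lemma IsRelTypical.isStarProjection (h : IsRelTypical ρ τ δ Pr) (n : ℕ) :
    IsStarProjection (Pr n) := (h.1 n).1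

lemma IsRelTypical.le_smul (h : IsRelTypical ρ τ δ Pr) (hτ : τ.PosSemidef) (n : ℕ) :
    Pr n ≤ Real.exp (n * (crossEntropy ρ τ + δ)) • tensorPow τ n := by
  obtain ⟨h1, h2, h3, -⟩ := h.1 n
  have := le_inv_smul (Real.exp_pos _)
    (h3.trans (mul_mul_self_le_of_commute h1 (tensorPow_posSemidef hτ n) h2))
  rwa [← Real.exp_neg, neg_neg] at this

/-- The upper eigenvalue bound for the inverse plays the role of a lower bound for `τ`; singular `τ`
is allowed. -/
lemma IsRelTypical.le_smul_of_opInv (h : IsRelTypical ρ (opInv τ) δ Pr) (hτ : τ.PosSemidef)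
    (n : ℕ) : Pr n ≤ Real.exp (n * (crossEntropy ρ τ + δ)) • tensorPow τ n := by
  obtain ⟨h1, h2, h3, h4⟩ := h.1 n
  have e : -(n * (crossEntropy ρ (opInv τ) - δ)) = n * (crossEntropy ρ τ + δ) := by
    rw [crossEntropy_opInv]; ring
  rw [e] at h4
  refine proj_le_smul_of_inv (tensorPow_posSemidef hτ n)
    (tensorPow_posSemidef (opInv_posSemidef hτ) n).1 ?_ ?_ h1 h2 (Real.exp_pos _)
    (Real.exp_pos _).le h3 h4
  · rw [← tensorPow_mul, ← tensorPow_mul, mul_opInv_comm τ]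
  · rw [← tensorPow_mul, ← tensorPow_mul, opInv_mul_mul hτ]

/-- The constant uses `√2 ≤ 3/2`; four such terms sum to `6`, and `√(2·6) ≤ 4` yields the final
prefactor. Each square root halves the rate. -/
lemma IsRelTypical.exists_weight (h : IsRelTypical ρ τ δ Pr) : ∃ η : ℝ, 0 < η ∧ ∀ n : ℕ,
    √(1 - (Pr n * tensorPow ρ n).trace.re) ≤ 3 / 2 * Real.exp (-(n * η)) := by
  obtain ⟨η, hη, H⟩ := h.2
  refine ⟨η / 2, by positivity, fun n => Real.sqrt_le_iff.2 ⟨by positivity, ?_⟩⟩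
  have e : (3 / 2 * Real.exp (-(n * (η / 2)))) ^ 2 = 9 / 4 * Real.exp (-(n * η)) := by
    rw [mul_pow, ← Real.exp_nat_mul]
    congr 1
    · norm_num
    · congr 1; push_cast; ring
  rw [e]
  linarith [H n, Real.exp_pos (-(n * η))]

lemma IsRelTypical.trace_le {Q : ∀ n : ℕ, Matrix (Fin n → ι) (Fin n → ι) ℂ}
    (h : IsRelTypical ρ ρ δ Q) (hρ : ρ.PosSemidef) (hρ1 : ρ.trace = 1) (n : ℕ) :
    (Q n).trace.re ≤ Real.exp (n * (crossEntropy ρ ρ + δ)) := by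
  have := trace_re_mono (h.le_smul hρ n)
  rwa [Matrix.trace_smul, trace_tensorPow, hρ1, one_pow, Complex.smul_re, Complex.one_re,
    smul_eq_mul, mul_one] at this

lemma exists_common_rate {f₁ f₂ f₃ f₄ : ℕ → ℝ}
    (h₁ : ∃ η : ℝ, 0 < η ∧ ∀ n : ℕ, f₁ n ≤ 3 / 2 * Real.exp (-(n * η)))
    (h₂ : ∃ η : ℝ, 0 < η ∧ ∀ n : ℕ, f₂ n ≤ 3 / 2 * Real.exp (-(n * η)))
    (h₃ : ∃ η : ℝ, 0 < η ∧ ∀ n : ℕ, f₃ n ≤ 3 / 2 * Real.exp (-(n * η)))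
    (h₄ : ∃ η : ℝ, 0 < η ∧ ∀ n : ℕ, f₄ n ≤ 3 / 2 * Real.exp (-(n * η))) :
    ∃ η : ℝ, 0 < η ∧ ∀ n : ℕ, f₁ n + f₂ n + (f₃ n + f₄ n) ≤ 6 * Real.exp (-(n * η)) := by
  obtain ⟨η₁, p₁, H₁⟩ := h₁
  obtain ⟨η₂, p₂, H₂⟩ := h₂
  obtain ⟨η₃, p₃, H₃⟩ := h₃
  obtain ⟨η₄, p₄, H₄⟩ := h₄
  set η := min (min η₁ η₂) (min η₃ η₄) with hη
  have key : ∀ η' : ℝ, η ≤ η' → ∀ n : ℕ, Real.exp (-(n * η')) ≤ Real.exp (-(n * η)) :=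
    fun η' h n => Real.exp_le_exp.2 (neg_le_neg (mul_le_mul_of_nonneg_left h n.cast_nonneg))
  refine ⟨η, lt_min (lt_min p₁ p₂) (lt_min p₃ p₄), fun n => ?_⟩
  linarith [H₁ n, H₂ n, H₃ n, H₄ n,
    key η₁ ((min_le_left _ _).trans (min_le_left _ _)) n,
    key η₂ ((min_le_left _ _).trans (min_le_right _ _)) n,
    key η₃ ((min_le_right _ _).trans (min_le_left _ _)) n,
    key η₄ ((min_le_right _ _).trans (min_le_right _ _)) n]

end RelTypical

/-! ### Bounding the coherent relative entropy. -/

section CoherentRelativeEntropy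

variable {ι κ r : Type*} [Fintype ι] [DecidableEq ι] [Fintype κ] [DecidableEq κ]
  [Fintype r] [DecidableEq r]

lemma le_cohRelEntropy {ε : ℝ} {σXR : Matrix (ι × r) (ι × r) ℂ} {ρXR : Matrix (κ × r) (κ × r) ℂ}
    {Γ : Matrix ι ι ℂ} {Γ' : Matrix κ κ ℂ} {y : ℝ} {T : Matrix ι ι ℂ →ₗ[ℂ] Matrix κ κ ℂ}
    (h1 : IsCompletelyPositive T) (h2 : IsTraceNonincreasing T)
    (h3 : T Γ ≤ Real.exp (-y) • Γ') (h4 : purifiedDist (applyLeft T σXR) ρXR ≤ ε) :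
    (y : EReal) ≤ cohRelEntropy ε σXR ρXR Γ Γ' := by
  rw [cohRelEntropy, EReal.le_neg]
  have h5 : ENNReal.log (ENNReal.ofReal (Real.exp (-y))) = -(y : EReal) := by
    rw [ENNReal.log_ofReal_of_pos (Real.exp_pos _), Real.log_exp, EReal.coe_neg]
  rw [← h5]
  refine ENNReal.log_le_log ?_
  exact iInf₂_le (α := ℝ≥0∞) (Real.exp (-y)).toNNReal
    ⟨T, h1, h2, by rwa [Real.coe_toNNReal _ (Real.exp_pos _).le], h4⟩

lemma cohRelEntropy_le {ε : ℝ} {σXR : Matrix (ι × r) (ι × r) ℂ} {ρXR : Matrix (κ × r) (κ × r) ℂ}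
    {Γ : Matrix ι ι ℂ} {Γ' : Matrix κ κ ℂ} {y : ℝ}
    (h : ∀ (T : Matrix ι ι ℂ →ₗ[ℂ] Matrix κ κ ℂ) (α : ℝ), 0 ≤ α → IsCompletelyPositive T →
      IsTraceNonincreasing T → T Γ ≤ α • Γ' → purifiedDist (applyLeft T σXR) ρXR ≤ ε →
      Real.exp (-y) ≤ α) :
    cohRelEntropy ε σXR ρXR Γ Γ' ≤ (y : EReal) := by
  rw [cohRelEntropy, EReal.neg_le]
  have h5 : ENNReal.log (ENNReal.ofReal (Real.exp (-y))) = -(y : EReal) := by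
    rw [ENNReal.log_ofReal_of_pos (Real.exp_pos _), Real.log_exp, EReal.coe_neg]
  rw [← h5]
  refine ENNReal.log_le_log (le_iInf₂ fun α hα => ?_)
  obtain ⟨T, h1, h2, h3, h4⟩ := hα
  have := h T α α.2 h1 h2 h3 h4
  rw [← ENNReal.ofReal_coe_nnreal]
  exact ENNReal.ofReal_le_ofReal this

/-- The purified distance never exceeds `1`, so the zero map is feasible with `α = 0`. -/
lemma cohRelEntropy_eq_top {ε : ℝ} (hε : 1 ≤ ε) (σXR : Matrix (ι × r) (ι × r) ℂ)
    (ρXR : Matrix (κ × r) (κ × r) ℂ) (Γ : Matrix ι ι ℂ) (Γ' : Matrix κ κ ℂ) :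
    cohRelEntropy ε σXR ρXR Γ Γ' = ⊤ := by
  rw [cohRelEntropy, EReal.neg_eq_top_iff, ENNReal.log_eq_bot_iff, ← nonpos_iff_eq_zero]
  refine iInf₂_le_of_le (0 : ℝ≥0) ⟨0, ?_, fun A hA => ?_, by simp, ?_⟩ (by simp)
  · rw [IsCompletelyPositive]
    have : applyLeft (0 : Matrix ι ι ℂ →ₗ[ℂ] Matrix κ κ ℂ) (ketBra (maxEntKet ι)) = 0 := by
      ext; simp [applyLeft]
    rw [this]
    exact Matrix.PosSemidef.zero
  · simpa using (Complex.le_def.1 hA.trace_nonneg).1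
  · refine (Real.sqrt_le_one.2 ?_).trans hε
    linarith [sq_nonneg (genFidelity (applyLeft (0 : Matrix ι ι ℂ →ₗ[ℂ] Matrix κ κ ℂ) σXR) ρXR)]

end CoherentRelativeEntropy

/-! ### Many copies: achievability, converse and limit. -/

section Main

variable {X X' : Type*} [Fintype X] [DecidableEq X] [Fintype X'] [DecidableEq X']
  {Γ : Matrix X X ℂ} {Γ' : Matrix X' X' ℂ} {E : Matrix X X ℂ →ₗ[ℂ] Matrix X' X' ℂ}
  {ψ : X × X → ℂ}

lemma isUnitKet_pow {ψ : X × X → ℂ} (hψ : IsUnitKet ψ) (n : ℕ) :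
    IsUnitKet fun p : (Fin n → X) × (Fin n → X) => ∏ k, ψ (p.1 k, p.2 k) := by
  have h1 := trace_ketBra hψ
  have h2 := trace_tensorPow (ptraceRight (ketBra ψ)) n
  rw [trace_ptraceRight, h1, one_pow, ← ptraceRight_tensorPow₂, tensorPow₂_ketBra,
    trace_ptraceRight, ketBra, Matrix.trace_vecMulVec, dotProduct] at h2
  rw [IsUnitKet]
  have h3 := congrArg Complex.re h2
  rw [Complex.re_sum, Complex.one_re] at h3
  rw [← h3]
  refine Finset.sum_congr rfl fun p _ => ?_
  rw [Pi.star_apply, RCLike.star_def, Complex.mul_conj', ← Complex.ofReal_pow, Complex.ofReal_re]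

/-- The smoothed tensor-power map: complete positivity, normalization and the `Γ` bound. -/
theorem sandwich_tensorPow (hΓ' : Γ'.PosSemidef)
    (hE : IsCompletelyPositive E) (hE' : IsTracePreserving E)
    {σ : Matrix X X ℂ} (hσ : σ.PosSemidef) {ρ : Matrix X' X' ℂ} (hρ : ρ = E σ) {δ : ℝ}
    {S Q : ∀ n : ℕ, Matrix (Fin n → X') (Fin n → X') ℂ}
    {P R : ∀ n : ℕ, Matrix (Fin n → X) (Fin n → X) ℂ}
    (hS : IsRelTypical ρ (opInv Γ') δ S) (hQ : IsRelTypical ρ ρ δ Q)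
    (hP : IsRelTypical σ Γ δ P) (hR : IsRelTypical σ σ δ R) (n : ℕ) :
    IsCompletelyPositive (sandwich (tensorPowMap E n) (S n) (Q n) (P n) (R n)) ∧
    IsTraceNonincreasing (sandwich (tensorPowMap E n) (S n) (Q n) (P n) (R n)) ∧
    sandwich (tensorPowMap E n) (S n) (Q n) (P n) (R n) (tensorPow Γ n) ≤
      Real.exp (-(n * (relEntropy σ Γ - relEntropy ρ Γ' - 4 * δ))) • tensorPow Γ' n := by
  obtain ⟨V, hV⟩ := exists_stinespring hE
  have hVn := hV.tensorPowMap n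
  have pS := hS.isStarProjection n
  have pQ := hQ.isStarProjection n
  have pP := hP.isStarProjection n
  have pR := hR.isStarProjection n
  refine ⟨(hVn.sandwich pS.isSelfAdjoint.star_eq pQ.isSelfAdjoint.star_eq
    pP.isSelfAdjoint.star_eq pR.isSelfAdjoint.star_eq).isCompletelyPositive,
    sandwich_isTraceNonincreasing hVn (tensorPowMap_isTracePreserving hE' n) pS pQ pP pR, ?_⟩
  have hEρ : Q n * tensorPowMap E n (tensorPow σ n) * Q n ≤
      Real.exp (-(n * (crossEntropy ρ ρ - δ))) • Q n := by
    rw [tensorPowMap_tensorPow, ← hρ]; exact (hQ.1 n).2.2.2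
  have := sandwich_le hVn pS pQ pP pR (Real.exp_pos _).le (Real.exp_pos _).le (Real.exp_pos _).le
    (hP.1 n).2.2.2 (hR.le_smul hσ n) hEρ (hS.le_smul_of_opInv hΓ' n)
  refine this.trans_eq ?_
  congr 1
  rw [← Real.exp_add, ← Real.exp_add, ← Real.exp_add, relEntropy_eq, relEntropy_eq]
  congr 1; ring

/-- The smoothed tensor-power map reproduces the process matrix exponentially well. -/
theorem exists_purifiedDist_sandwich_le (hE : IsCompletelyPositive E) (hE' : IsTracePreserving E)
    (hψ : IsUnitKet ψ) {σ : Matrix X X ℂ} (hσ : σ = ptraceRight (ketBra ψ))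
    {ρ : Matrix X' X' ℂ} (hρ : ρ = E σ) {δ : ℝ} {τ : Matrix X' X' ℂ}
    {S Q : ∀ n : ℕ, Matrix (Fin n → X') (Fin n → X') ℂ}
    {P R : ∀ n : ℕ, Matrix (Fin n → X) (Fin n → X) ℂ}
    (hS : IsRelTypical ρ τ δ S) (hQ : IsRelTypical ρ ρ δ Q)
    (hP : IsRelTypical σ Γ δ P) (hR : IsRelTypical σ σ δ R) :
    ∃ η' : ℝ, 0 < η' ∧ ∀ n : ℕ,
      purifiedDist (applyLeft (sandwich (tensorPowMap E n) (S n) (Q n) (P n) (R n))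
          (tensorPow₂ (ketBra ψ) n)) (tensorPow₂ (applyLeft E (ketBra ψ)) n) ≤
        4 * Real.exp (-(n * η')) := by
  obtain ⟨V, hV⟩ := exists_stinespring hE
  obtain ⟨η, hη, H⟩ := exists_common_rate hS.exists_weight hQ.exists_weight hR.exists_weight
    hP.exists_weight
  refine ⟨η / 2, by positivity, fun n => ?_⟩
  have hs : tensorPow σ n =
      ptraceRight (ketBra fun p : (Fin n → X) × (Fin n → X) => ∏ k, ψ (p.1 k, p.2 k)) := by
    rw [hσ, ← ptraceRight_tensorPow₂, tensorPow₂_ketBra]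
  have := purifiedDist_sandwich_le (hV.tensorPowMap n) (tensorPowMap_isTracePreserving hE' n)
    (hS.isStarProjection n) (hQ.isStarProjection n) (hP.isStarProjection n)
    (hR.isStarProjection n) (isUnitKet_pow hψ n) hs
  rw [tensorPowMap_tensorPow, ← hρ] at this
  rw [tensorPow₂_applyLeft, tensorPow₂_ketBra]
  refine this.trans (Real.sqrt_le_iff.2 ⟨by positivity, ?_⟩)
  have e : (4 * Real.exp (-(n * (η / 2)))) ^ 2 = 16 * Real.exp (-(n * η)) := by
    rw [mul_pow, ← Real.exp_nat_mul]
    congr 1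
    · norm_num
    · congr 1; push_cast; ring
  rw [e]
  linarith [H n, Real.exp_pos (-(n * η))]

lemma tendsto_exp_neg_nat_mul {η : ℝ} (hη : 0 < η) :
    Tendsto (fun n : ℕ => Real.exp (-(n * η))) atTop (𝓝 0) :=
  Real.tendsto_exp_neg_atTop_nhds_zero.comp
    (tendsto_natCast_atTop_atTop.atTop_mul_const hη)

/-- Achievability: a lower bound for the coherent relative entropy of many copies. -/
theorem eventually_le_cohRelEntropy (hΓ' : Γ'.PosSemidef)
    (hE : IsCompletelyPositive E) (hE' : IsTracePreserving E)
    (hψ : IsUnitKet ψ) {σ : Matrix X X ℂ} (hσ : σ = ptraceRight (ketBra ψ))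
    {ρ : Matrix X' X' ℂ} (hρ : ρ = E σ) {δ : ℝ}
    {S Q : ∀ n : ℕ, Matrix (Fin n → X') (Fin n → X') ℂ}
    {P R : ∀ n : ℕ, Matrix (Fin n → X) (Fin n → X) ℂ}
    (hS : IsRelTypical ρ (opInv Γ') δ S) (hQ : IsRelTypical ρ ρ δ Q)
    (hP : IsRelTypical σ Γ δ P) (hR : IsRelTypical σ σ δ R) {ε : ℝ} (hε : 0 < ε) :
    ∀ᶠ n : ℕ in atTop, ((n * (relEntropy σ Γ - relEntropy ρ Γ' - 4 * δ) : ℝ) : EReal) ≤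
      cohRelEntropy ε (tensorPow₂ (ketBra ψ) n) (tensorPow₂ (applyLeft E (ketBra ψ)) n)
        (tensorPow Γ n) (tensorPow Γ' n) := by
  have hσ' : σ.PosSemidef := by rw [hσ]; exact ptraceRight_posSemidef (ketBra_posSemidef ψ)
  obtain ⟨η, hη, H⟩ := exists_purifiedDist_sandwich_le hE hE' hψ hσ hρ hS hQ hP hR
  have ht := (tendsto_exp_neg_nat_mul hη).const_mul 4
  rw [mul_zero] at ht
  filter_upwards [ht.eventually (gt_mem_nhds hε)] with n hn
  obtain ⟨h1, h2, h3⟩ := sandwich_tensorPow hΓ' hE hE' hσ' hρ hS hQ hP hR n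
  exact le_cohRelEntropy h1 h2 h3 ((H n).trans hn.le)

/-- Converse: an upper bound for the coherent relative entropy of many copies. -/
theorem eventually_cohRelEntropy_le (hΓ : Γ.PosSemidef)
    (hE : IsCompletelyPositive E) (hE' : IsTracePreserving E)
    (hψ : IsUnitKet ψ) {σ : Matrix X X ℂ} (hσ : σ = ptraceRight (ketBra ψ))
    {ρ : Matrix X' X' ℂ} (hρ : ρ = E σ) {δ : ℝ} (hδ : 0 < δ)
    {S Q : ∀ n : ℕ, Matrix (Fin n → X') (Fin n → X') ℂ}
    {P R : ∀ n : ℕ, Matrix (Fin n → X) (Fin n → X) ℂ}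
    (hS : IsRelTypical ρ Γ' δ S) (hQ : IsRelTypical ρ ρ δ Q)
    (hP : IsRelTypical σ Γ δ P) (hR : IsRelTypical σ σ δ R) {ε : ℝ} (hε : 0 < ε) (hε1 : ε < 1) :
    ∀ᶠ n : ℕ in atTop,
      cohRelEntropy ε (tensorPow₂ (ketBra ψ) n) (tensorPow₂ (applyLeft E (ketBra ψ)) n)
        (tensorPow Γ n) (tensorPow Γ' n) ≤
      ((n * (relEntropy σ Γ - relEntropy ρ Γ' + 5 * δ) : ℝ) : EReal) := by
  obtain ⟨W, hW⟩ := exists_stinespring hE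
  have hσ1 : σ.trace = 1 := by rw [hσ, trace_ptraceRight, trace_ketBra hψ]
  have hσ' : σ.PosSemidef := by rw [hσ]; exact ptraceRight_posSemidef (ketBra_posSemidef ψ)
  have hρ1 : ρ.trace = 1 := by rw [hρ, hE', hσ1]
  have hρ' : ρ.PosSemidef := by rw [hρ]; exact hW.posSemidef hσ'
  obtain ⟨η, hη, H⟩ := exists_common_rate hP.exists_weight hR.exists_weight hS.exists_weight
    hQ.exists_weight
  set f := √(1 - ε ^ 2) with hf
  have hfp : 0 < f := Real.sqrt_pos.2 (by nlinarith)
  have ht := (tendsto_exp_neg_nat_mul hη).const_mul 6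
  rw [mul_zero] at ht
  -- For large `n` the projection losses stay below `f / 2`, and `e^{-nδ}` is below the constant `(f
  -- / 2)²`; absorbing that constant costs the fifth `δ`.
  filter_upwards [ht.eventually (gt_mem_nhds (half_pos hfp)),
    (tendsto_exp_neg_nat_mul hδ).eventually (gt_mem_nhds (pow_pos (half_pos hfp) 2))] with n hn hn'
  refine cohRelEntropy_le fun T α hα hT hT' hTΓ hd => ?_
  obtain ⟨V, hV⟩ := exists_stinespring hT
  have hs : tensorPow σ n =
      ptraceRight (ketBra fun p : (Fin n → X) × (Fin n → X) => ∏ k, ψ (p.1 k, p.2 k)) := by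
    rw [hσ, ← ptraceRight_tensorPow₂, tensorPow₂_ketBra]
  have hω : tensorPow₂ (applyLeft E (ketBra ψ)) n = applyLeft (tensorPowMap E n)
      (ketBra fun p : (Fin n → X) × (Fin n → X) => ∏ k, ψ (p.1 k, p.2 k)) := by
    rw [tensorPow₂_applyLeft, tensorPow₂_ketBra]
  have hωt : tensorPow ρ n = ptraceRight (tensorPow₂ (applyLeft E (ketBra ψ)) n) := by
    rw [ptraceRight_tensorPow₂, ptraceRight_applyLeft, ← hσ, ← hρ]
  have hωp : (tensorPow₂ (applyLeft E (ketBra ψ)) n).PosSemidef := by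
    rw [hω, (hW.tensorPowMap n).applyLeft_ketBra]
    exact Matrix.posSemidef_self_mul_conjTranspose _
  have hω1 : (tensorPow₂ (applyLeft E (ketBra ψ)) n).trace = 1 := by
    rw [← trace_ptraceRight, ← hωt, trace_tensorPow, hρ1, one_pow]
  rw [tensorPow₂_ketBra ψ n] at hd
  have key := sqrt_le_of_purifiedDist_le hV hT' (hS.isStarProjection n) (hQ.isStarProjection n)
    (hP.isStarProjection n) (hR.isStarProjection n) (isUnitKet_pow hψ n) hs hωp hω1 hωt hd hα
    (Real.exp_pos _).le (Real.exp_pos _).le (Real.exp_pos _).le hTΓ (hS.1 n).2.2.2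
    (hQ.trace_le hρ' hρ1 n) (hR.1 n).2.2.2 (hP.le_smul hΓ n)
  set M := n * (relEntropy σ Γ - relEntropy ρ Γ' + 4 * δ) with hM
  have e : Real.exp (-(n * (crossEntropy σ σ - δ))) * Real.exp (n * (crossEntropy σ Γ + δ)) * α *
      Real.exp (-(n * (crossEntropy ρ Γ' - δ))) * Real.exp (n * (crossEntropy ρ ρ + δ)) =
      α * Real.exp M := by
    have : M = -(n * (crossEntropy σ σ - δ)) + n * (crossEntropy σ Γ + δ) +
        -(n * (crossEntropy ρ Γ' - δ)) + n * (crossEntropy ρ ρ + δ) := by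
      rw [hM, relEntropy_eq, relEntropy_eq]; ring
    rw [this, Real.exp_add, Real.exp_add, Real.exp_add]; ring
  rw [e] at key
  have h1 : f / 2 ≤ √(α * Real.exp M) := by linarith [H n]
  have h2 : (f / 2) ^ 2 ≤ α * Real.exp M := by
    rwa [Real.le_sqrt' (half_pos hfp)] at h1
  have h3 : Real.exp (-(n * δ)) ≤ α * Real.exp M := hn'.le.trans h2
  have h4 : Real.exp (-(n * (relEntropy σ Γ - relEntropy ρ Γ' + 5 * δ))) =
      Real.exp (-(n * δ)) * Real.exp (-M) := by
    rw [← Real.exp_add, hM]; congr 1; ring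
  rw [h4, Real.exp_neg M, ← div_eq_mul_inv, div_le_iff₀ (Real.exp_pos M)]
  exact h3

lemma tendsto_div_nat_of_bounds {u : ℕ → EReal} {D : ℝ}
    (hl : ∀ δ : ℝ, 0 < δ → ∀ᶠ n : ℕ in atTop, ((n * (D - 4 * δ) : ℝ) : EReal) ≤ u n)
    (hu : ∀ δ : ℝ, 0 < δ → ∀ᶠ n : ℕ in atTop, u n ≤ ((n * (D + 5 * δ) : ℝ) : EReal)) :
    Tendsto (fun n : ℕ => u n / (n : EReal)) atTop (𝓝 (D : EReal)) := by
  have hpos : ∀ n : ℕ, 0 < n → (0 : EReal) < (n : EReal) := fun n hn => by exact_mod_cast hn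
  have hcast : ∀ n : ℕ, (n : EReal) = ((n : ℝ) : EReal) := fun n => by simp
  have htop : ∀ n : ℕ, (n : EReal) ≠ ⊤ := fun n => by rw [hcast]; exact EReal.coe_ne_top _
  refine tendsto_order.2 ⟨fun a ha => ?_, fun a ha => ?_⟩
  · obtain ⟨q, hq1, hq2⟩ := EReal.lt_iff_exists_real_btwn.1 ha
    have hq2 : q < D := EReal.coe_lt_coe_iff.1 hq2
    -- This `δ` makes the lower bound exactly `n q`.
    filter_upwards [hl ((D - q) / 4) (by linarith), eventually_gt_atTop 0] with n hn hn0
    refine hq1.trans_le ?_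
    rw [EReal.le_div_iff_mul_le (hpos n hn0) (htop n), hcast, ← EReal.coe_mul]
    refine le_trans (le_of_eq ?_) hn
    congr 1; ring
  · obtain ⟨q, hq1, hq2⟩ := EReal.lt_iff_exists_real_btwn.1 ha
    have hq1 : D < q := EReal.coe_lt_coe_iff.1 hq1
    filter_upwards [hu ((q - D) / 5) (by linarith), eventually_gt_atTop 0] with n hn hn0
    refine lt_of_le_of_lt ?_ hq2
    rw [EReal.div_le_iff_le_mul (hpos n hn0) (htop n), hcast, ← EReal.coe_mul]
    refine hn.trans (le_of_eq ?_)
    congr 1; ring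

end Main

end

end QInfo

theorem mainTheorem7 {X X' : Type*} [Fintype X] [DecidableEq X] [Fintype X'] [DecidableEq X']
    (Γ : Matrix X X ℂ) (hΓ : Γ.PosSemidef) (Γ' : Matrix X' X' ℂ) (hΓ' : Γ'.PosSemidef)
    (E : Matrix X X ℂ →ₗ[ℂ] Matrix X' X' ℂ)
    (hE : QInfo.IsCompletelyPositive E) (hE' : QInfo.IsTracePreserving E)
    -- a pure state on `X ⊗ R`, with `R` a copy of `X`, and its reduced state
    (ψ : X × X → ℂ) (hψ : QInfo.IsUnitKet ψ)
    (σ : Matrix X X ℂ) (hσ : σ = QInfo.ptraceRight (QInfo.ketBra ψ))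
    -- the process matrix `ρ_{X'R} = (E ⊗ id)(|ψ⟩⟨ψ|)` and its reduced state
    (ρXR : Matrix (X' × X) (X' × X) ℂ) (hρXR : ρXR = QInfo.applyLeft E (QInfo.ketBra ψ))
    (ρ : Matrix X' X' ℂ) (hρ : ρ = QInfo.ptraceRight ρXR)
    -- the two relative entropies are defined
    (hσΓ : QInfo.SuppLE σ Γ) (hρΓ' : QInfo.SuppLE ρ Γ') :
    (∀ δ : ℝ, 0 < δ →
      QInfo.IsRelTypical ρ (QInfo.opInv Γ') δ (QInfo.relTypProj ρ (QInfo.opInv Γ') δ) ∧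
      QInfo.IsRelTypical ρ ρ δ (QInfo.relTypProj ρ ρ δ) ∧
      QInfo.IsRelTypical σ Γ δ (QInfo.relTypProj σ Γ δ) ∧
      QInfo.IsRelTypical σ σ δ (QInfo.relTypProj σ σ δ)) ∧
    (∀ δ : ℝ, 0 < δ →
      ∀ (S Q : ∀ n : ℕ, Matrix (Fin n → X') (Fin n → X') ℂ)
        (P R : ∀ n : ℕ, Matrix (Fin n → X) (Fin n → X) ℂ),
        QInfo.IsRelTypical ρ (QInfo.opInv Γ') δ S → QInfo.IsRelTypical ρ ρ δ Q →
        QInfo.IsRelTypical σ Γ δ P → QInfo.IsRelTypical σ σ δ R →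
        ∀ T : ∀ n : ℕ, Matrix (Fin n → X) (Fin n → X) ℂ →ₗ[ℂ]
            Matrix (Fin n → X') (Fin n → X') ℂ,
          (∀ n, T n = QInfo.sandwich (QInfo.tensorPowMap E n) (S n) (Q n) (P n) (R n)) →
          (∀ n : ℕ, QInfo.IsCompletelyPositive (T n) ∧ QInfo.IsTraceNonincreasing (T n) ∧
            T n (QInfo.tensorPow Γ n) ≤
              Real.exp (-(n * (QInfo.relEntropy σ Γ - QInfo.relEntropy ρ Γ' - 4 * δ))) •
                QInfo.tensorPow Γ' n) ∧
          ∃ η' : ℝ, 0 < η' ∧ ∀ n : ℕ,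
            QInfo.purifiedDist
                (QInfo.applyLeft (T n) (QInfo.tensorPow₂ (QInfo.ketBra ψ) n))
                (QInfo.tensorPow₂ ρXR n)
              ≤ 4 * Real.exp (-(n * η'))) ∧
    (∀ ε : ℝ, 0 < ε → ∃ L : EReal,
      Tendsto (fun n : ℕ =>
          QInfo.cohRelEntropy ε (QInfo.tensorPow₂ (QInfo.ketBra ψ) n) (QInfo.tensorPow₂ ρXR n)
            (QInfo.tensorPow Γ n) (QInfo.tensorPow Γ' n) / (n : EReal))
        atTop (𝓝 L) ∧
      ((QInfo.relEntropy σ Γ - QInfo.relEntropy ρ Γ' : ℝ) : EReal) ≤ L) := by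
  obtain ⟨V, hV⟩ := QInfo.exists_stinespring hE
  have hρσ : ρ = E σ := by rw [hρ, hρXR, QInfo.ptraceRight_applyLeft, ← hσ]
  have hσ' : σ.PosSemidef := by
    rw [hσ]; exact QInfo.ptraceRight_posSemidef (QInfo.ketBra_posSemidef ψ)
  have hσ1 : σ.trace = 1 := by rw [hσ, QInfo.trace_ptraceRight, QInfo.trace_ketBra hψ]
  have hρ' : ρ.PosSemidef := by rw [hρσ]; exact hV.posSemidef hσ'
  have hρ1 : ρ.trace = 1 := by rw [hρσ, hE', hσ1]
  have part1 : ∀ δ : ℝ, 0 < δ →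
      QInfo.IsRelTypical ρ (QInfo.opInv Γ') δ (QInfo.relTypProj ρ (QInfo.opInv Γ') δ) ∧
      QInfo.IsRelTypical ρ ρ δ (QInfo.relTypProj ρ ρ δ) ∧
      QInfo.IsRelTypical σ Γ δ (QInfo.relTypProj σ Γ δ) ∧
      QInfo.IsRelTypical σ σ δ (QInfo.relTypProj σ σ δ) := fun δ hδ =>
    ⟨QInfo.isRelTypical_relTypProj hρ' hρ1 (QInfo.opInv_posSemidef hΓ') (hρΓ'.opInv hΓ') hδ,
      QInfo.isRelTypical_relTypProj hρ' hρ1 hρ' (QInfo.suppLE_refl ρ) hδ,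
      QInfo.isRelTypical_relTypProj hσ' hσ1 hΓ hσΓ hδ,
      QInfo.isRelTypical_relTypProj hσ' hσ1 hσ' (QInfo.suppLE_refl σ) hδ⟩
  refine ⟨part1, fun δ _ S Q P R hS hQ hP hR T hT => ?_, fun ε hε => ?_⟩
  · obtain rfl : T = fun n => QInfo.sandwich (QInfo.tensorPowMap E n) (S n) (Q n) (P n) (R n) :=
      funext hT
    refine ⟨QInfo.sandwich_tensorPow hΓ' hE hE' hσ' hρσ hS hQ hP hR, ?_⟩
    rw [hρXR]
    exact QInfo.exists_purifiedDist_sandwich_le hE hE' hψ hσ hρσ hS hQ hP hR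
  · rcases lt_or_ge ε 1 with hε1 | hε1
    -- For `ε < 1` the limit is the difference of relative entropies itself, hence `le_rfl`.
    · refine ⟨_, QInfo.tendsto_div_nat_of_bounds (fun δ hδ => ?_) (fun δ hδ => ?_), le_rfl⟩
      · obtain ⟨hS, hQ, hP, hR⟩ := part1 δ hδ
        rw [hρXR]
        exact QInfo.eventually_le_cohRelEntropy hΓ' hE hE' hψ hσ hρσ hS hQ hP hR hε
      · obtain ⟨-, hQ, hP, hR⟩ := part1 δ hδ
        rw [hρXR]
        exact QInfo.eventually_cohRelEntropy_le hΓ hE hE' hψ hσ hρσ hδ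
          (QInfo.isRelTypical_relTypProj hρ' hρ1 hΓ' hρΓ' hδ) hQ hP hR hε hε1
    · refine ⟨⊤, tendsto_const_nhds.congr' ?_, le_top⟩
      -- `n = 0` is excluded because `⊤ / 0` is not `⊤` in `EReal`.
      filter_upwards [eventually_gt_atTop 0] with n hn
      rw [QInfo.cohRelEntropy_eq_top hε1, EReal.top_div_of_pos_ne_top (by exact_mod_cast hn)]
      exact EReal.coe_ne_top (n : ℝ)
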